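/- **Theorem (Cohn).** For a real number $X$, let $N(X)$ be the number of isomorphism classes of abelian cubic fields (that is, number fields $K$ of degree $3$ over $\mathbb{Q}$ that are Galois over $\mathbb{Q}$ with abelian Galois group) whose absolute discriminant satisfies $\mathrm{Disc}(K) < X$. Then $N(X)$ is finite for every $X$, the product $\prod_{p\equiv 1\,(\mathrm{mod}\,3)}\bigl(1-\frac{2}{p(p+1)}\bigr)$ over all primes $p\equiv 1 \pmod 3$ converges unconditionally, and, as $X\to\infty$, $$N(X)=\frac{11\sqrt3}{36\pi}\prod_{\substack{p\ \mathrm{prime}\\ p\equiv 1\,(\mathrm{mod}\,3)}}\Bigl(1-\frac{2}{p(p+1)}\Bigr)\cdot X^{1/2}+o(X^{1/2}).$$ -/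

import Mathlib

open Filter Asymptotics

/-- An abelian cubic field: a number field of degree 3 over `ℚ` that is Galois over `ℚ` with
abelian Galois group. -/
structure AbelianCubicField : Type 1 where
  /-- the underlying type -/
  carrier : Type
  [field : Field carrier]
  [numberField : NumberField carrier]
  /-- the degree over `ℚ` is 3 -/
  finrank_eq : Module.finrank ℚ carrier = 3
  /-- the field is an abelian (Galois) extension of `ℚ` -/
  isAbelian : IsAbelianGalois ℚ carrier

namespace AbelianCubicField

instance (F : AbelianCubicField) : Field F.carrier := F.field

instance (F : AbelianCubicField) : NumberField F.carrier := F.numberField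

/-- Two abelian cubic fields are identified when they are isomorphic over `ℚ`
(equivalently, isomorphic as fields). -/
instance isoSetoid : Setoid AbelianCubicField where
  r F G := Nonempty (F.carrier ≃ₐ[ℚ] G.carrier)
  iseqv :=
    { refl := fun _ => ⟨AlgEquiv.refl⟩
      symm := fun ⟨e⟩ => ⟨e.symm⟩
      trans := fun ⟨e⟩ ⟨f⟩ => ⟨e.trans f⟩ }

/-- The isomorphism classes of abelian cubic fields. -/
def IsoClass : Type 1 := Quotient isoSetoid

/-- The absolute discriminant, as a function of the isomorphism class. -/
noncomputable def IsoClass.discr : IsoClass → ℤ :=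
  Quotient.lift (fun F : AbelianCubicField => NumberField.discr F.carrier)
    (fun _ _ ⟨e⟩ => NumberField.discr_eq_discr_of_algEquiv _ e)

/-- The set of isomorphism classes of abelian cubic fields of discriminant less than `X`. -/
def discrLT (X : ℝ) : Set IsoClass := {c | (c.discr : ℝ) < X}

end AbelianCubicField

/-- The primes that are congruent to 1 modulo 3. -/
abbrev PrimeOneModThree : Type := {p : ℕ // p.Prime ∧ p ≡ 1 [MOD 3]}

/-! Let K be an abelian cubic field and s a generator of its Galois group. On the plane of
trace-zero elements s satisfies s² + s + 1 = 0, so this plane is a line over ℚ(ω) with ω acting as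
s. For t ≠ 0 in it, t² = 2n + g t + h s(t), where n is the norm of the resolvent γ = g + hω
(`IsResolvent`). Multiplying t by e in ℚ(ω) replaces γ by Γ with Γ e = ē² γ, and replacing s by its
inverse conjugates γ.

Unique factorization in ℤ[ω] provides, for each s, a resolvent whose norm is squarefree and prime to
3 (`exists_reduced_isResolvent`), unique up to sign (`resolvent_unique`). The reduced resolvents of
K are therefore ±γ, ±γ̄, four distinct elements. Conversely every reduced γ with h ≠ 0 occurs, in
the field generated by a root of X³ − 3nX − n(2g − h) (`exists_field_attached`). The discriminant is
f², with f = n if 3 ∣ h and f = 9n otherwise (`discr_eq_of_isReduced`).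

So 4N(X) + 2 counts the reduced γ with f < √X, the 2 standing for γ = ±1, where h = 0. If a(n) is
the number of reduced elements of norm n congruent to 1 mod 3, then 2a(n) reduced elements of norm n
have 3 ∣ h and 4a(n) do not. With A(Y) = ∑_{n<Y} a(n) this gives 4N(X) + 2 = 2A(√X) + 4A(√X/9)
(`card_discrLT`).

The function a is multiplicative and supported on squarefree numbers, with a(p) = 2 for p ≡ 1 mod 3
and a(p) = 0 for all other primes. Hence a = ζ * χ * c, with χ the nontrivial character mod 3 and ∑
c(d)/d absolutely convergent. Since the sums of ζ * χ up to m are asymptotic to L(1, χ) m = π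
m/(3√3), dominated convergence gives A(Y) ~ π/(3√3) · ∑ c(d)/d · Y. The Euler product of ∑ c(d)/d,
compared with that of 1/ζ(2), equals 9/(2π²) times the product in the theorem. The constant is then
(1/2 + 1/9) · √3/(2π) = 11√3/(36π). -/

/-- The ring `ℤ[ω]` of Eisenstein integers, where `ω ^ 2 + ω + 1 = 0`. -/
abbrev EisensteinInt : Type := QuadraticAlgebra ℤ (-1) (-1)

/-! ### Eisenstein integers: Euclidean division, units and splitting of primes -/

namespace EisensteinInt

open QuadraticAlgebra

/-- The norm `g ^ 2 - g * h + h ^ 2` of `g + h * ω`. -/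
abbrev nrm : EisensteinInt →* ℤ := QuadraticAlgebra.norm

theorem norm_eq (x : EisensteinInt) : nrm x = x.re ^ 2 - x.re * x.im + x.im ^ 2 := by
  rw [norm_def]; ring

theorem four_mul_norm (x : EisensteinInt) :
    4 * nrm x = (2 * x.re - x.im) ^ 2 + 3 * x.im ^ 2 := by
  rw [norm_eq]; ring

theorem norm_nonneg (x : EisensteinInt) : 0 ≤ nrm x := by
  nlinarith [four_mul_norm x, sq_nonneg (2 * x.re - x.im), sq_nonneg x.im]

theorem norm_eq_zero {x : EisensteinInt} : nrm x = 0 ↔ x = 0 := by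
  refine ⟨fun h => ?_, fun h => by simp [h]⟩
  have h4 := four_mul_norm x
  have h1 : x.im ^ 2 = 0 := by nlinarith [sq_nonneg (2 * x.re - x.im), sq_nonneg x.im]
  have h2 : x.im = 0 := by simpa using h1
  have h3 : x.re ^ 2 = 0 := by rw [norm_eq, h2] at h; simpa using h
  ext
  · simpa using h3
  · simpa using h2

theorem norm_pos {x : EisensteinInt} (hx : x ≠ 0) : 0 < nrm x :=
  lt_of_le_of_ne (norm_nonneg x) fun h => hx (norm_eq_zero.1 h.symm)

theorem mul_star_self (x : EisensteinInt) : x * star x = (nrm x : EisensteinInt) := by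
  rw [← algebraMap_norm_eq_mul_star]; rfl

instance : Div EisensteinInt where
  div x y := ⟨round ((x * star y).re / nrm y : ℚ), round ((x * star y).im / nrm y : ℚ)⟩

instance : Mod EisensteinInt where
  mod x y := x - y * (x / y)

theorem norm_mod_lt (x : EisensteinInt) {y : EisensteinInt} (hy : y ≠ 0) :
    nrm (x % y) < nrm y := by
  have hn : (0 : ℚ) < nrm y := by exact_mod_cast norm_pos hy
  set a : ℚ := ((x * star y).re : ℚ) / nrm y with ha
  set b : ℚ := ((x * star y).im : ℚ) / nrm y with hb
  have hd : x / y = ⟨round a, round b⟩ := rfl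
  have h1 := abs_sub_round a
  have h2 := abs_sub_round b
  have key : ((nrm (x % y) : ℤ) : ℚ) = nrm y *
      ((a - round a) ^ 2 - (a - round a) * (b - round b) + (b - round b) ^ 2) := by
    have e1 : ((nrm (x % y) : ℤ) : ℚ) * nrm y =
        ((nrm ((x * star y) - (nrm y : EisensteinInt) * (x / y)) : ℤ) : ℚ) := by
      have : x * star y - (nrm y : EisensteinInt) * (x / y) = (x % y) * star y := by
        rw [← mul_star_self]; change _ = (x - y * (x / y)) * _; ring
      rw [this, map_mul, QuadraticAlgebra.norm_star]; push_cast; ring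
    have ea : ((x * star y).re : ℚ) = a * nrm y := by rw [ha]; field_simp
    have eb : ((x * star y).im : ℚ) = b * nrm y := by rw [hb]; field_simp
    have e2 : ((nrm ((x * star y) - (nrm y : EisensteinInt) * (x / y)) : ℤ) : ℚ) =
        (nrm y) ^ 2 * ((a - round a) ^ 2 - (a - round a) * (b - round b) + (b - round b) ^ 2) := by
      rw [hd, norm_eq]
      simp only [re_sub, im_sub, re_mul, im_mul, re_intCast, im_intCast] at ea eb ⊢
      push_cast at ea eb ⊢
      simp only [ea, eb]
      ring
    rw [e2] at e1
    refine mul_right_cancel₀ hn.ne' ?_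
    rw [e1]
    ring
  have : ((nrm (x % y) : ℤ) : ℚ) < nrm y := by
    rw [key]
    -- Both differences are at most 1/2 in absolute value, so the form is at most 3/4.
    have hlt : (a - round a) ^ 2 - (a - round a) * (b - round b) + (b - round b) ^ 2 < 1 := by
      rw [abs_le] at h1 h2
      nlinarith [mul_nonneg (sub_nonneg.2 h1.2) (sub_nonneg.2 h2.2),
        mul_nonneg (neg_le_iff_add_nonneg.1 h1.1) (neg_le_iff_add_nonneg.1 h2.1),
        mul_nonneg (sub_nonneg.2 h1.2) (neg_le_iff_add_nonneg.1 h1.1),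
        mul_nonneg (sub_nonneg.2 h2.2) (neg_le_iff_add_nonneg.1 h2.1),
        mul_nonneg (sub_nonneg.2 h1.2) (neg_le_iff_add_nonneg.1 h2.1),
        mul_nonneg (sub_nonneg.2 h2.2) (neg_le_iff_add_nonneg.1 h1.1)]
    nlinarith
  exact_mod_cast this

noncomputable instance : EuclideanDomain EisensteinInt :=
  { (inferInstance : CommRing EisensteinInt),
    (inferInstance : Nontrivial EisensteinInt) with
    quotient := (· / ·)
    remainder := (· % ·)
    quotient_zero := fun x => by
      change (⟨round _, round _⟩ : EisensteinInt) = 0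
      simp; rfl
    quotient_mul_add_remainder_eq := fun x y => by
      change y * (x / y) + (x - y * (x / y)) = x; ring
    r := fun x y => (nrm x).natAbs < (nrm y).natAbs
    r_wellFounded := (measure fun x : EisensteinInt => (nrm x).natAbs).wf
    remainder_lt := fun x y hy =>
      Int.natAbs_lt_natAbs_of_nonneg_of_lt (norm_nonneg _) (norm_mod_lt x hy)
    mul_left_not_lt := fun x y hy h => by
      rw [map_mul, Int.natAbs_mul] at h
      have := Int.natAbs_pos.2 (norm_pos hy).ne'
      exact absurd h (not_lt.2 (Nat.le_mul_of_pos_right _ this)) }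

theorem isUnit_iff_norm_eq_one {x : EisensteinInt} : IsUnit x ↔ nrm x = 1 := by
  rw [isUnit_iff_norm_isUnit, Int.isUnit_iff]
  have := norm_nonneg x
  exact ⟨fun h => h.resolve_right fun h => by linarith, Or.inl⟩

/-- The units are the sixth roots of unity. This is why a sign is the only ambiguity of a reduced
resolvent for a fixed generator of the Galois group. -/
theorem pow_three_of_isUnit {x : EisensteinInt} (hx : IsUnit x) : x ^ 3 = 1 ∨ x ^ 3 = -1 := by
  rw [isUnit_iff_norm_eq_one] at hx
  have h4 := four_mul_norm x
  rw [hx] at h4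
  have hi : x.im ^ 2 ≤ 1 := by nlinarith [sq_nonneg (2 * x.re - x.im)]
  have hr : x.re ^ 2 ≤ 1 := by
    rw [norm_eq] at hx; nlinarith [sq_nonneg (2 * x.im - x.re)]
  have hi' := abs_le.1 ((sq_le_one_iff_abs_le_one _).1 hi)
  have hr' := abs_le.1 ((sq_le_one_iff_abs_le_one _).1 hr)
  rw [norm_eq] at hx
  obtain ⟨a, b⟩ := x
  simp only at *
  obtain ⟨h1, h2⟩ := hi'
  obtain ⟨h3, h4⟩ := hr'
  interval_cases a <;> interval_cases b <;> first | omega | (left; rfl) | (right; rfl)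

theorem isUnit_of_norm_mul_lt {a b : EisensteinInt} {p : ℕ} (hp : p.Prime)
    (h : a * b = (p : EisensteinInt)) (ha : ¬ IsUnit a) (hb : ¬ IsUnit b) : nrm a = p := by
  have h1 : nrm a * nrm b = (p : ℤ) ^ 2 := by rw [← map_mul, h, QuadraticAlgebra.norm_natCast]
  rw [isUnit_iff_norm_eq_one] at ha hb
  have ha0 := norm_nonneg a
  have hb0 := norm_nonneg b
  lift nrm a to ℕ using ha0 with m
  lift nrm b to ℕ using hb0 with n
  norm_cast at *
  have hm : m ∣ p ^ 2 := ⟨n, h1.symm⟩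
  obtain ⟨i, hi, rfl⟩ := (Nat.dvd_prime_pow hp).1 hm
  interval_cases i
  · simp at ha
  · simp
  · have : 0 < p ^ 2 := pow_pos hp.pos 2
    exact absurd (by nlinarith : n = 1) hb

theorem norm_emod_three (x : EisensteinInt) : nrm x % 3 = 0 ∨ nrm x % 3 = 1 := by
  rw [norm_eq]
  have e : x.re ^ 2 - x.re * x.im + x.im ^ 2 = (x.re + x.im) ^ 2 - 3 * (x.re * x.im) := by ring
  rw [e]
  rcases (by omega : (x.re + x.im) % 3 = 0 ∨ (x.re + x.im) % 3 = 1 ∨ (x.re + x.im) % 3 = 2) with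
    h | h | h <;> simp [Int.sub_emod, pow_two, Int.mul_emod, h]

theorem prime_of_mod_three_eq_two {p : ℕ} (hp : p.Prime) (h : p % 3 = 2) :
    Prime (p : EisensteinInt) := by
  rw [← irreducible_iff_prime]
  refine ⟨fun hu => ?_, fun a b hab => ?_⟩
  · rw [isUnit_iff_norm_eq_one, QuadraticAlgebra.norm_natCast] at hu
    have := hp.one_lt
    norm_cast at hu
    nlinarith
  · by_contra! hc
    have := isUnit_of_norm_mul_lt hp hab.symm hc.1 hc.2
    have := norm_emod_three a
    omega

theorem star_dvd_star {a b : EisensteinInt} : star a ∣ star b ↔ a ∣ b := by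
  constructor
  · rintro ⟨c, hc⟩
    exact ⟨star c, by rw [← star_star b, hc, star_mul, star_star, mul_comm]⟩
  · rintro ⟨c, rfl⟩
    exact ⟨star c, by rw [star_mul, mul_comm]⟩

theorem intCast_dvd {n : ℤ} {x : EisensteinInt} :
    (n : EisensteinInt) ∣ x ↔ n ∣ x.re ∧ n ∣ x.im := algebraMap_dvd_iff

theorem natCast_dvd_of_dvd_norm {p : ℕ} (hp : p.Prime) (h : p % 3 = 2) {x : EisensteinInt}
    (hx : (p : ℤ) ∣ nrm x) : (p : EisensteinInt) ∣ x := by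
  have h1 : (p : EisensteinInt) ∣ x * star x := by
    rw [mul_star_self]
    obtain ⟨k, hk⟩ := hx
    exact ⟨k, by rw [hk]; push_cast; rfl⟩
  rcases (prime_of_mod_three_eq_two hp h).dvd_or_dvd h1 with h2 | h2
  · exact h2
  · rw [← star_dvd_star, star_star] at h2
    simpa using h2

theorem irreducible_of_norm_prime {p : ℕ} (hp : p.Prime) {x : EisensteinInt}
    (hx : nrm x = p) : Irreducible x := by
  refine ⟨fun hu => ?_, fun a b hab => ?_⟩
  · rw [isUnit_iff_norm_eq_one, hx] at hu
    exact hp.one_lt.ne' (by exact_mod_cast hu)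
  · have h1 : nrm a * nrm b = (p : ℤ) := by rw [← map_mul, ← hab, hx]
    rw [isUnit_iff_norm_eq_one, isUnit_iff_norm_eq_one]
    have ha0 := norm_nonneg a
    have hb0 := norm_nonneg b
    lift nrm a to ℕ using ha0 with m
    lift nrm b to ℕ using hb0 with n
    norm_cast at *
    rcases (Nat.dvd_prime hp).1 ⟨n, h1.symm⟩ with rfl | rfl
    · exact Or.inl rfl
    · right
      exact Nat.eq_of_mul_eq_mul_left hp.pos (by simpa using h1)

/-- The group of units mod p has an element of order 3, so p divides some z² + z + 1 = (z − ω)(z + 1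
+ ω) without dividing either factor. Hence p is not prime in ℤ[ω], and a proper factor of p has norm
p. -/
theorem exists_norm_eq {p : ℕ} (hp : p.Prime) (h : p % 3 = 1) :
    ∃ x : EisensteinInt, nrm x = p := by
  have := Fact.mk hp
  have h3 : ∃ z : ℤ, (p : ℤ) ∣ z ^ 2 + z + 1 := by
    have hd : 3 ∣ Fintype.card (ZMod p)ˣ := by
      rw [ZMod.card_units]; omega
    have : Fact (Nat.Prime 3) := ⟨Nat.prime_three⟩
    obtain ⟨u, hu⟩ := exists_prime_orderOf_dvd_card 3 hd
    have hu1 : (u : ZMod p) ≠ 1 := by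
      intro h1
      have : u = 1 := Units.ext h1
      simp [this] at hu
    have hu3 : (u : ZMod p) ^ 3 = 1 := by
      rw [← Units.val_pow_eq_pow_val, ← hu, pow_orderOf_eq_one]; rfl
    obtain ⟨z, hz⟩ := ZMod.intCast_surjective (u : ZMod p)
    refine ⟨z, ?_⟩
    rw [← ZMod.intCast_zmod_eq_zero_iff_dvd]
    push_cast
    rw [hz]
    have : ((u : ZMod p) - 1) * ((u : ZMod p) ^ 2 + u + 1) = 0 := by linear_combination hu3
    exact (mul_eq_zero.1 this).resolve_left (sub_ne_zero.2 hu1)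
  obtain ⟨z, hz⟩ := h3
  have hnp : ¬ Prime (p : EisensteinInt) := by
    intro hpr
    have hd : (p : EisensteinInt) ∣ (⟨z, -1⟩ : EisensteinInt) * ⟨z + 1, 1⟩ := by
      obtain ⟨k, hk⟩ := hz
      refine ⟨k, ?_⟩
      ext
      · simp; linarith
      · simp
    have hp1 : ¬ (p : ℤ) ∣ 1 := by
      have := hp.one_lt
      intro h1
      have := Int.le_of_dvd one_pos h1
      omega
    rcases hpr.dvd_or_dvd hd with h1 | h1
    · have := (intCast_dvd (n := (p : ℤ)).1 (by simpa using h1)).2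
      exact hp1 (by simpa using this)
    · have := (intCast_dvd (n := (p : ℤ)).1 (by simpa using h1)).2
      exact hp1 (by simpa using this)
  rw [← irreducible_iff_prime, irreducible_iff] at hnp
  have hpu : ¬ IsUnit (p : EisensteinInt) := by
    rw [isUnit_iff_norm_eq_one, QuadraticAlgebra.norm_natCast]
    have := hp.one_lt
    norm_cast
    nlinarith
  push Not at hnp
  obtain ⟨a, b, hab, ha, hb⟩ := hnp hpu
  exact ⟨a, isUnit_of_norm_mul_lt hp hab.symm ha hb⟩

end EisensteinInt

/-! ### Counting Eisenstein integers of given norm by primary representatives -/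

namespace EisensteinInt

open QuadraticAlgebra

theorem finite_nrm_le (B : ℤ) : {x : EisensteinInt | nrm x ≤ B}.Finite := by
  have hfin : (Set.Icc (-(2 * B)) (2 * B) ×ˢ Set.Icc (-(2 * B)) (2 * B) : Set (ℤ × ℤ)).Finite :=
    (Set.finite_Icc _ _).prod (Set.finite_Icc _ _)
  refine (hfin.image (fun q => (⟨q.1, q.2⟩ : EisensteinInt))).subset fun x hx => ?_
  have hx : nrm x ≤ B := hx
  have h0 := norm_nonneg x
  have h4 := four_mul_norm x
  have h4' : 4 * nrm x = (2 * x.im - x.re) ^ 2 + 3 * x.re ^ 2 := by rw [norm_eq]; ring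
  have hle : ∀ t : ℤ, 3 * t ^ 2 ≤ 4 * B → t ∈ Set.Icc (-(2 * B)) (2 * B) := by
    intro t ht
    have h5 : |t| ≤ t ^ 2 := by
      rw [← sq_abs]
      rcases (abs_nonneg t).eq_or_lt with h | h
      · rw [← h]; simp
      · nlinarith
    have h6 := abs_le.1 (h5.trans (by linarith : t ^ 2 ≤ 2 * B))
    exact h6
  refine ⟨(x.re, x.im), ⟨hle _ ?_, hle _ ?_⟩, rfl⟩
  · nlinarith [sq_nonneg (2 * x.im - x.re)]
  · nlinarith [sq_nonneg (2 * x.re - x.im)]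

theorem finite_nrm_eq (n : ℤ) : {x : EisensteinInt | nrm x = n}.Finite :=
  (finite_nrm_le n).subset fun _ hx => le_of_eq hx

/-- An Eisenstein integer is primary if it is congruent to `1` modulo `3`. -/
def IsPrimary (x : EisensteinInt) : Prop := 3 ∣ x.re - 1 ∧ 3 ∣ x.im

theorem IsPrimary.star {x : EisensteinInt} (hx : IsPrimary x) : IsPrimary (star x) := by
  obtain ⟨h1, h2⟩ := hx
  constructor
  · rw [re_star]; omega
  · rw [im_star]; omega

theorem isPrimary_mul_iff {x y : EisensteinInt} (hx : IsPrimary x) :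
    IsPrimary (x * y) ↔ IsPrimary y := by
  obtain ⟨⟨a, ha⟩, ⟨b, hb⟩⟩ := hx
  have h1 : (x * y).re = y.re + 3 * (a * y.re - b * y.im) := by
    simp only [re_mul, hb]
    linear_combination y.re * ha
  have h2 : (x * y).im = y.im + 3 * (a * y.im + b * y.re - b * y.im) := by
    simp only [im_mul, hb]
    linear_combination y.im * ha
  unfold IsPrimary
  rw [h1, h2]
  omega

theorem isPrimary_neg_iff {x : EisensteinInt} : IsPrimary (-x) ↔ 3 ∣ x.re + 1 ∧ 3 ∣ x.im := by
  unfold IsPrimary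
  rw [re_neg, im_neg]
  omega

theorem three_dvd_im_iff {x : EisensteinInt} (hx : ¬ (3 : ℤ) ∣ nrm x) :
    3 ∣ x.im ↔ IsPrimary x ∨ IsPrimary (-x) := by
  rw [isPrimary_neg_iff]
  unfold IsPrimary
  constructor
  · intro h
    have : ¬ (3 : ℤ) ∣ x.re := by
      rintro ⟨a, ha⟩
      obtain ⟨b, hb⟩ := h
      apply hx
      rw [norm_eq, ha, hb]
      exact ⟨3 * a ^ 2 - 3 * a * b + 3 * b ^ 2, by ring⟩
    omega
  · rintro (h | h) <;> exact h.2

theorem not_three_dvd_re_add_im {x : EisensteinInt} (hx : ¬ (3 : ℤ) ∣ nrm x) :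
    ¬ 3 ∣ x.re + x.im := by
  rintro ⟨a, ha⟩
  apply hx
  rw [norm_eq]
  exact ⟨a * (x.re + x.im) - x.re * x.im, by linear_combination (x.re + x.im) * ha⟩

theorem nrm_omega : nrm (omega : EisensteinInt) = 1 := by rfl

theorem omega_pow_three : (omega : EisensteinInt) ^ 3 = 1 := by rfl

theorem re_omega_mul (x : EisensteinInt) : (omega * x).re = -x.im := by simp

theorem im_omega_mul (x : EisensteinInt) : (omega * x).im = x.re - x.im := by simp; ring

/-- The number of primary Eisenstein integers of a given norm. -/
noncomputable def primaryCount (n : ℕ) : ℕ := {x : EisensteinInt | nrm x = n ∧ IsPrimary x}.ncard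

theorem finite_primary (n : ℕ) : {x : EisensteinInt | nrm x = n ∧ IsPrimary x}.Finite :=
  (finite_nrm_eq n).subset fun _ hx => hx.1

theorem ncard_three_dvd_im {n : ℕ} (hn : ¬ 3 ∣ n) :
    {x : EisensteinInt | nrm x = n ∧ 3 ∣ x.im}.ncard = 2 * primaryCount n := by
  have h : {x : EisensteinInt | nrm x = n ∧ 3 ∣ x.im} =
      {x : EisensteinInt | nrm x = n ∧ IsPrimary x} ∪
        Neg.neg '' {x : EisensteinInt | nrm x = n ∧ IsPrimary x} := by
    ext x
    simp only [Set.mem_ofPred_eq, Set.mem_union, Set.image_neg_eq_neg, Set.mem_neg,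
      QuadraticAlgebra.norm_neg, ← and_or_left]
    refine and_congr_right fun hx => three_dvd_im_iff ?_
    rw [hx]
    exact_mod_cast hn
  rw [h, Set.ncard_union_eq _ (finite_primary n) ((finite_primary n).image _),
    Set.ncard_image_of_injective _ neg_injective, primaryCount, two_mul]
  rw [Set.disjoint_left]
  rintro x ⟨-, h1⟩ h2
  rw [Set.image_neg_eq_neg] at h2
  have h2 := (isPrimary_neg_iff.1 h2.2).1
  have h1 := h1.1
  omega

/-- For x = g + hω the numbers x, ωx, ω²x have ω-coordinates h, g − h, −g. As 3 does not divide g +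
h, exactly one of these is divisible by 3. Multiplication by ω and by ω² thus carries the elements
with 3 ∣ h onto two disjoint sets that make up the rest. -/
theorem ncard_not_three_dvd_im {n : ℕ} (hn : ¬ 3 ∣ n) :
    {x : EisensteinInt | nrm x = n ∧ ¬ 3 ∣ x.im}.ncard = 4 * primaryCount n := by
  set S := {x : EisensteinInt | nrm x = n ∧ 3 ∣ x.im} with hS
  have hSf : S.Finite := (finite_nrm_eq n).subset fun _ hx => hx.1
  have hw : (omega : EisensteinInt) ≠ 0 := by
    intro h
    have := nrm_omega
    rw [h] at this
    simp at this
  have hinj : Function.Injective (fun x : EisensteinInt => omega * x) := fun x y hxy =>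
    mul_left_cancel₀ hw hxy
  have hinj2 : Function.Injective (fun x : EisensteinInt => omega * (omega * x)) :=
    hinj.comp hinj
  have key : ∀ x : EisensteinInt, nrm x = n → ¬ 3 ∣ x.re + x.im := fun x hx =>
    not_three_dvd_re_add_im (by rw [hx]; exact_mod_cast hn)
  have h3 : ∀ x : EisensteinInt, omega * (omega * (omega * x)) = x := fun x => by
    linear_combination x * omega_pow_three
  have h : {x : EisensteinInt | nrm x = n ∧ ¬ 3 ∣ x.im} =
      (fun x => omega * x) '' S ∪ (fun x => omega * (omega * x)) '' S := by
    ext x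
    constructor
    · rintro ⟨hx, hx3⟩
      have := key x hx
      by_cases hr : 3 ∣ x.re
      · left
        refine ⟨omega * (omega * x), ⟨by rw [map_mul, map_mul, nrm_omega, hx]; simp, ?_⟩, h3 x⟩
        rw [im_omega_mul, im_omega_mul, re_omega_mul]; omega
      · right
        refine ⟨omega * x, ⟨by rw [map_mul, nrm_omega, hx, one_mul], ?_⟩, h3 x⟩
        rw [im_omega_mul]
        rcases (by omega : x.im % 3 = 1 ∨ x.im % 3 = 2) with h | h <;> omega
    · rintro (⟨y, ⟨hy, hy3⟩, rfl⟩ | ⟨y, ⟨hy, hy3⟩, rfl⟩)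
      · have := key y hy
        refine ⟨by simp only [map_mul, nrm_omega, hy, one_mul], ?_⟩
        simp only [im_omega_mul]; omega
      · have := key y hy
        refine ⟨by simp only [map_mul, nrm_omega, hy, one_mul], ?_⟩
        simp only [im_omega_mul, re_omega_mul]; omega
  rw [h, Set.ncard_union_eq _ (hSf.image _) (hSf.image _), Set.ncard_image_of_injective _ hinj,
    Set.ncard_image_of_injective _ hinj2, ncard_three_dvd_im hn]
  · ring
  · rw [Set.disjoint_left]
    rintro _ ⟨y, ⟨hy, hy3⟩, rfl⟩ ⟨z, ⟨hz, hz3⟩, hyz⟩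
    have hyz := hinj hyz
    have := key z hz
    rw [← show omega * z = y from hyz, im_omega_mul] at hy3
    omega

theorem exists_primary_nrm_eq {p : ℕ} (hp : p.Prime) (h : p % 3 = 1) :
    ∃ x : EisensteinInt, nrm x = p ∧ IsPrimary x := by
  obtain ⟨x, hx⟩ := exists_norm_eq hp h
  have h3 : ¬ 3 ∣ p := by omega
  have hne : ({x : EisensteinInt | nrm x = p ∧ 3 ∣ x.im} ∪
      {x : EisensteinInt | nrm x = p ∧ ¬ 3 ∣ x.im}).Nonempty :=
    ⟨x, by by_cases h : 3 ∣ x.im <;> [left; right] <;> exact ⟨hx, h⟩⟩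
  have hc : primaryCount p ≠ 0 := by
    intro h0
    have h1 := ncard_three_dvd_im h3
    have h2 := ncard_not_three_dvd_im h3
    rw [h0, mul_zero, Set.ncard_eq_zero ((finite_nrm_eq p).subset fun _ hx => hx.1)] at h1 h2
    rw [h1, h2] at hne
    simp at hne
  exact Set.nonempty_of_ncard_ne_zero hc

theorem primaryCount_one : primaryCount 1 = 1 := by
  rw [primaryCount, Set.ncard_eq_one]
  refine ⟨1, ?_⟩
  ext x
  simp only [Nat.cast_one, Set.mem_ofPred_eq, Set.mem_singleton_iff]
  constructor
  · rintro ⟨h, ⟨a, ha⟩, ⟨b, hb⟩⟩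
    have h4 := four_mul_norm x
    have hb0 : b = 0 := by
      by_contra hb0
      have : 0 < b ^ 2 := by positivity
      rw [h, hb] at h4
      nlinarith [sq_nonneg (2 * x.re - 3 * b)]
    rw [hb0, mul_zero] at hb
    rw [norm_eq, hb] at h
    have h5 : (x.re - 1) * (x.re + 1) = 0 := by linarith
    ext
    · rcases mul_eq_zero.1 h5 with h6 | h6
      · simp; omega
      · omega
    · simpa using hb
  · rintro rfl
    exact ⟨by simp, by simp [IsPrimary]⟩

/-- Write p = q q̄ with q primary. A primary x of norm pm is q or q̄ times a primary element of norm
m, and not both ways: q does not divide elements of norm m, and q, q̄ are not associates. -/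
theorem primaryCount_prime_mul {p m : ℕ} (hp : p.Prime) (h : p % 3 = 1) (hm : ¬ p ∣ m) :
    primaryCount (p * m) = 2 * primaryCount m := by
  obtain ⟨q, hq, hqp⟩ := exists_primary_nrm_eq hp h
  have hqs : nrm (star q) = p := by rw [QuadraticAlgebra.norm_star, hq]
  have hq0 : ∀ q : EisensteinInt, nrm q = p → q ≠ 0 := by
    rintro q hq rfl
    rw [QuadraticAlgebra.norm_zero] at hq
    exact hp.ne_zero (by exact_mod_cast hq.symm)
  have hpr : ∀ q : EisensteinInt, nrm q = p → Prime q := fun q hq =>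
    (irreducible_of_norm_prime hp hq).prime
  have hinj : ∀ q : EisensteinInt, nrm q = p → Function.Injective (fun x => q * x) :=
    fun q hq x y hxy => mul_left_cancel₀ (hq0 q hq) hxy
  set S := {x : EisensteinInt | nrm x = m ∧ IsPrimary x} with hS
  have hmem : ∀ q x : EisensteinInt, nrm q = p → IsPrimary q → nrm (q * x) = ((p * m : ℕ) : ℤ) →
      IsPrimary (q * x) → x ∈ S := by
    intro q x hq hqp h1 h2
    refine ⟨?_, (isPrimary_mul_iff hqp).1 h2⟩
    rw [map_mul, hq] at h1
    push_cast at h1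
    exact mul_left_cancel₀ (by exact_mod_cast hp.ne_zero) h1
  have hset : {x : EisensteinInt | nrm x = ((p * m : ℕ) : ℤ) ∧ IsPrimary x} =
      (fun x => q * x) '' S ∪ (fun x => star q * x) '' S := by
    ext x
    constructor
    · rintro ⟨h1, h2⟩
      have h3 : q ∣ x * star x := by
        rw [mul_star_self, h1]
        push_cast
        rw [← Int.cast_natCast p, ← hq, ← mul_star_self, mul_assoc]
        exact dvd_mul_right _ _
      rcases (hpr q hq).dvd_or_dvd h3 with ⟨y, rfl⟩ | h4
      · exact Or.inl ⟨y, hmem q y hq hqp h1 h2, rfl⟩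
      · rw [← star_dvd_star, star_star] at h4
        obtain ⟨y, rfl⟩ := h4
        exact Or.inr ⟨y, hmem _ y hqs hqp.star h1 h2, rfl⟩
    · rintro (⟨y, ⟨hy, hy3⟩, rfl⟩ | ⟨y, ⟨hy, hy3⟩, rfl⟩)
      · exact ⟨by simp [map_mul, hq, hy], (isPrimary_mul_iff hqp).2 hy3⟩
      · exact ⟨by simp only [map_mul, hqs, hy]; push_cast; rfl, (isPrimary_mul_iff hqp.star).2 hy3⟩
  rw [primaryCount, hset, Set.ncard_union_eq _ ((finite_primary m).image _)
    ((finite_primary m).image _), Set.ncard_image_of_injective _ (hinj q hq),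
    Set.ncard_image_of_injective _ (hinj _ hqs), primaryCount, two_mul]
  rw [Set.disjoint_left]
  rintro _ ⟨y, ⟨hy, hy3⟩, rfl⟩ ⟨z, ⟨hz, hz3⟩, hyz⟩
  simp only at hyz
  have hd : q ∣ star q * z := ⟨y, hyz⟩
  rcases (hpr q hq).dvd_or_dvd hd with h1 | h1
  · -- `q` divides its conjugate: then `p` divides a trace, hence `p ∣ 3 * q.im ^ 2`
    obtain ⟨u, hu⟩ := h1
    have hu1 : nrm u = 1 := by
      have := congrArg nrm hu
      rw [hqs, map_mul, hq] at this
      have hp0 : (p : ℤ) ≠ 0 := by exact_mod_cast hp.ne_zero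
      exact (mul_left_cancel₀ hp0 (by linarith))
    have hup : IsPrimary u := (isPrimary_mul_iff hqp).1 (hu ▸ hqp.star)
    have hu2 : u ∈ {x : EisensteinInt | nrm x = (1 : ℕ) ∧ IsPrimary x} := ⟨by simpa using hu1, hup⟩
    obtain ⟨v, hv⟩ := Set.ncard_eq_one.1 primaryCount_one
    have h1v : (1 : EisensteinInt) ∈ {x : EisensteinInt | nrm x = (1 : ℕ) ∧ IsPrimary x} :=
      ⟨by simp, by simp [IsPrimary]⟩
    rw [hv, Set.mem_singleton_iff] at hu2 h1v
    rw [hu2, ← h1v, mul_one] at hu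
    have him := congrArg QuadraticAlgebra.im hu
    rw [im_star] at him
    have him0 : q.im = 0 := by omega
    rw [norm_eq, him0] at hq
    have : IsSquare (p : ℤ) := ⟨q.re, by rw [← hq]; ring⟩
    exact (Nat.prime_iff_prime_int.1 hp).not_isSquare this
  · apply hm
    obtain ⟨w, rfl⟩ := h1
    rw [map_mul, hq] at hz
    exact Int.natCast_dvd_natCast.1 ⟨_, hz.symm⟩

theorem primaryCount_eq_zero {p n : ℕ} (hp : p.Prime) (h : p % 3 = 2) (hpn : p ∣ n)
    (hn : Squarefree n) : primaryCount n = 0 := by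
  rw [primaryCount, Set.ncard_eq_zero (finite_primary n), Set.eq_empty_iff_forall_notMem]
  rintro x ⟨hx, -⟩
  obtain ⟨y, rfl⟩ := natCast_dvd_of_dvd_norm hp h (x := x) (by rw [hx]; exact_mod_cast hpn)
  rw [map_mul, QuadraticAlgebra.norm_natCast] at hx
  have : p * p ∣ n := by
    rw [← Int.natCast_dvd_natCast, ← hx]
    exact ⟨nrm y, by push_cast; ring⟩
  exact hp.one_lt.ne' (Nat.isUnit_iff.1 (hn p this))

end EisensteinInt

/-! ### Reduced elements: representatives modulo the action of ℚ(ω) -/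

namespace EisensteinInt

open QuadraticAlgebra

/-- Eisenstein integers whose norm is squarefree and prime to `3`. -/
def IsReduced (x : EisensteinInt) : Prop := Squarefree (nrm x) ∧ ¬ (3 : ℤ) ∣ nrm x

theorem IsReduced.ne_zero {x : EisensteinInt} (hx : IsReduced x) : nrm x ≠ 0 := hx.1.ne_zero

theorem dvd_nrm_of_dvd {x y : EisensteinInt} (h : x ∣ y) : nrm x ∣ nrm y := map_dvd nrm h

/-- The norm of a common divisor d divides n and the norm τ² of x + x̄, where τ = 2g − h. By 4n = τ²
+ 3h², a prime p dividing that norm divides 3h². So p = 3, or p divides both g and h and p² ∣ n;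
both are excluded. -/
theorem IsReduced.isUnit_of_dvd_of_dvd_star {x d : EisensteinInt} (hx : IsReduced x)
    (h1 : d ∣ x) (h2 : d ∣ star x) : IsUnit d := by
  rw [isUnit_iff_norm_eq_one]
  by_contra hd
  obtain ⟨p, hp, hpd⟩ := Nat.exists_prime_and_dvd (n := (nrm d).natAbs) (by
    have := norm_nonneg d
    omega)
  have hpd : (p : ℤ) ∣ nrm d := Int.natCast_dvd.2 hpd
  have hpp := Nat.prime_iff_prime_int.1 hp
  have hpf : (p : ℤ) ∣ nrm x := hpd.trans (dvd_nrm_of_dvd h1)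
  have e1 : nrm (x + star x) = (2 * x.re - x.im) ^ 2 := by
    rw [norm_eq]; simp; ring
  have h3 : (p : ℤ) ∣ 2 * x.re - x.im := by
    refine hpp.dvd_of_dvd_pow (n := 2) ?_
    rw [← e1]
    exact hpd.trans (dvd_nrm_of_dvd (dvd_add h1 h2))
  have h4 : (p : ℤ) ∣ 3 * x.im ^ 2 := by
    have : 3 * x.im ^ 2 = 4 * nrm x - (2 * x.re - x.im) * (2 * x.re - x.im) := by
      rw [four_mul_norm]; ring
    rw [this]
    exact dvd_sub (hpf.mul_left _) (h3.mul_left _)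
  rcases hpp.dvd_or_dvd h4 with h5 | h5
  · have : p = 3 := (Nat.prime_dvd_prime_iff_eq hp Nat.prime_three).1 (by exact_mod_cast h5)
    subst this
    exact hx.2 hpf
  · have h6 := hpp.dvd_of_dvd_pow h5
    have h7 : (p : ℤ) ∣ x.re := by
      refine hpp.dvd_of_dvd_pow (n := 2) ?_
      have : x.re ^ 2 = nrm x - (x.im - x.re) * x.im := by rw [norm_eq]; ring
      rw [this]
      exact dvd_sub hpf (h6.mul_left _)
    obtain ⟨a, ha⟩ := h6
    obtain ⟨b, hb⟩ := h7
    have : (p : ℤ) * p ∣ nrm x := ⟨b ^ 2 - b * a + a ^ 2, by rw [norm_eq, ha, hb]; ring⟩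
    exact hpp.not_isUnit (hx.1 _ this)

/-- Here x · N(x) = x² x̄, with x and x̄ coprime and neither divisible by the square of a prime; so
no prime occurs three times. -/
theorem IsReduced.isUnit_of_pow_three_dvd {x d : EisensteinInt} (hx : IsReduced x)
    (h : d ^ 3 ∣ x * (nrm x : EisensteinInt)) : IsUnit d := by
  by_contra hd
  have hd0 : d ≠ 0 := by
    rintro rfl
    rw [zero_pow three_ne_zero, zero_dvd_iff, mul_eq_zero] at h
    rcases h with h | h
    · exact hx.ne_zero (by rw [h]; simp)
    · exact hx.ne_zero (by exact_mod_cast h)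
  obtain ⟨q, hq, hqd⟩ := WfDvdMonoid.exists_irreducible_factor hd hd0
  have hq := hq.prime
  have h1 : q ^ 3 ∣ x ^ 2 * star x := by
    have e : x ^ 2 * star x = x * (nrm x : EisensteinInt) := by rw [← mul_star_self]; ring
    rw [e]
    exact (pow_dvd_pow_of_dvd hqd 3).trans h
  have hsq : ∀ y : EisensteinInt, nrm y = nrm x → q ^ 2 ∣ y → False := by
    intro y hy h2
    have h3 := dvd_nrm_of_dvd h2
    rw [map_pow, hy, pow_two] at h3
    exact hq.not_isUnit (isUnit_iff_norm_isUnit.2 (hx.1 _ h3))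
  by_cases hs : q ∣ star x
  · have hqx : ¬ q ∣ x := fun h2 => hq.not_isUnit (hx.isUnit_of_dvd_of_dvd_star h2 hs)
    have h2 := hq.pow_dvd_of_dvd_mul_left 3 (fun h3 => hqx (hq.dvd_of_dvd_pow h3)) h1
    exact hsq (star x) (QuadraticAlgebra.norm_star x) ((pow_dvd_pow q (by norm_num)).trans h2)
  · have h2 := hq.pow_dvd_of_dvd_mul_right 3 hs h1
    have h3 : q ∣ x := hq.dvd_of_dvd_pow ((dvd_pow_self q three_ne_zero).trans h2)
    obtain ⟨y, rfl⟩ := h3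
    have h4 : q ^ 2 * q ∣ q ^ 2 * y ^ 2 := by
      have e1 : q ^ 3 = q ^ 2 * q := by ring
      have e2 : (q * y) ^ 2 = q ^ 2 * y ^ 2 := by ring
      rwa [e1, e2] at h2
    have h5 := hq.dvd_of_dvd_pow ((mul_dvd_mul_iff_left (pow_ne_zero 2 hq.ne_zero)).1 h4)
    obtain ⟨z, rfl⟩ := h5
    exact hsq _ rfl ⟨z, by ring⟩

/-- A reduced x is determined up to sign by the class of x · N(x) modulo cubes. Once common factors
of d and e are removed, d³ and e³ divide cube-free elements, so d and e are units, with cubes ±1.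
Comparing norms gives N(x) = N(y). -/
theorem IsReduced.eq_or_eq_neg {x y d e : EisensteinInt} (hx : IsReduced x) (hy : IsReduced y)
    (he : e ≠ 0) (h : y * (nrm y : EisensteinInt) * e ^ 3 = x * (nrm x : EisensteinInt) * d ^ 3) :
    y = x ∨ y = -x := by
  obtain ⟨a, b, hab⟩ := IsBezout.gcd_eq_sum d e
  obtain ⟨d', hd'⟩ := IsBezout.gcd_dvd_left d e
  obtain ⟨e', he'⟩ := IsBezout.gcd_dvd_right d e
  set k := IsBezout.gcd d e
  have hk : k ≠ 0 := fun hk => he (by rw [he', hk, zero_mul])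
  have hcop : IsCoprime d' e' := ⟨a, b, mul_left_cancel₀ hk (by
    linear_combination hab - a * hd' - b * he')⟩
  have h' : y * (nrm y : EisensteinInt) * e' ^ 3 = x * (nrm x : EisensteinInt) * d' ^ 3 := by
    refine mul_left_cancel₀ (pow_ne_zero 3 hk) ?_
    calc _ = y * (nrm y : EisensteinInt) * (k * e') ^ 3 := by ring
      _ = x * (nrm x : EisensteinInt) * (k * d') ^ 3 := by rw [← he', ← hd', h]
      _ = _ := by ring
  have hcop3 : IsCoprime (d' ^ 3) (e' ^ 3) := hcop.pow
  have hd1 : IsUnit d' := hy.isUnit_of_pow_three_dvd (hcop3.dvd_of_dvd_mul_right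
    (h' ▸ dvd_mul_left _ _))
  have he1 : IsUnit e' := hx.isUnit_of_pow_three_dvd (hcop3.symm.dvd_of_dvd_mul_right
    (h' ▸ dvd_mul_left _ _))
  have hn : nrm y = nrm x := by
    have := congrArg nrm h'
    simp only [map_mul, map_pow, isUnit_iff_norm_eq_one.1 hd1, isUnit_iff_norm_eq_one.1 he1,
      QuadraticAlgebra.norm_intCast, one_pow, mul_one, Int.cast_id] at this
    have h3 : (nrm y) ^ 3 = (nrm x) ^ 3 := by linarith
    exact (pow_left_inj₀ (norm_nonneg y) (norm_nonneg x) three_ne_zero).1 h3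
  rw [hn] at h'
  have hx0 : (nrm x : EisensteinInt) ≠ 0 := by exact_mod_cast hx.ne_zero
  have h2 : y * e' ^ 3 = x * d' ^ 3 := mul_left_cancel₀ hx0 (by linear_combination h')
  rcases pow_three_of_isUnit hd1 with h3 | h3 <;> rcases pow_three_of_isUnit he1 with h4 | h4 <;>
    rw [h3, h4] at h2
  · left; simpa using h2
  · right; linear_combination -h2
  · right; linear_combination h2
  · left; linear_combination -h2

/-- A reduction step is available for elements that are not reduced. -/
theorem exists_star_sq_dvd {x : EisensteinInt} (hx0 : x ≠ 0) (hx : ¬ IsReduced x) :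
    ∃ d : EisensteinInt, 1 < nrm d ∧ star d ^ 2 ∣ x * d := by
  have hnat : ∀ p : ℕ, p.Prime → (p : EisensteinInt) ∣ x →
      ∃ d : EisensteinInt, 1 < nrm d ∧ star d ^ 2 ∣ x * d := by
    intro p hp h
    refine ⟨p, ?_, ?_⟩
    · rw [QuadraticAlgebra.norm_natCast]
      have := hp.one_lt
      norm_cast
      nlinarith
    · rw [star_natCast, pow_two]
      exact mul_dvd_mul_right h _
  by_cases h3 : (3 : ℤ) ∣ nrm x
  -- 1 + 2ω is √−3: its conjugate squares to −3, and √−3 divides every element of norm divisible by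
  -- 3.
  · refine ⟨⟨1, 2⟩, by rw [norm_eq]; norm_num, ?_⟩
    have h4 : (3 : ℤ) ∣ x.re + x.im := by
      refine Int.prime_three.dvd_of_dvd_pow (n := 2) ?_
      have : (x.re + x.im) ^ 2 = nrm x + 3 * (x.re * x.im) := by rw [norm_eq]; ring
      rw [this]
      exact dvd_add h3 (dvd_mul_right _ _)
    obtain ⟨a, ha⟩ := h4
    have e1 : star (⟨1, 2⟩ : EisensteinInt) ^ 2 = -3 := by rfl
    have e2 : x * (⟨1, 2⟩ : EisensteinInt) = -3 * ⟨2 * a - x.re, a - x.re⟩ := by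
      have e3 : (-3 : EisensteinInt) = (⟨-3, 0⟩ : EisensteinInt) := rfl
      rw [e3]
      ext
      · simp; linarith
      · simp; linarith
    rw [e1, e2]
    exact dvd_mul_right _ _
  · have hsf : ¬ Squarefree (nrm x) := fun h => hx ⟨h, h3⟩
    have hsf' : ¬ Squarefree (nrm x).natAbs := by rwa [Int.squarefree_natAbs]
    rw [Nat.squarefree_iff_prime_squarefree] at hsf'
    push Not at hsf'
    obtain ⟨p, hp, hpp⟩ := hsf'
    have hpp : ((p * p : ℕ) : ℤ) ∣ nrm x := Int.natCast_dvd.2 hpp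
    have hpx : (p : ℤ) ∣ nrm x :=
      (by push_cast; exact dvd_mul_right _ _ : (p : ℤ) ∣ (p * p : ℕ)).trans hpp
    have hp3 : p % 3 = 1 ∨ p % 3 = 2 := by
      by_contra hc
      have : 3 ∣ p := by omega
      rw [Nat.prime_dvd_prime_iff_eq Nat.prime_three hp] at this
      subst this
      exact h3 hpx
    rcases hp3 with hp1 | hp2
    -- If q ∣ x but q̄ ∤ x, then p² ∣ N(x) forces q² ∣ x, and d = q̄ works. If both divide x, either
    -- q̄ ∣ q and d = q works, or p ∣ x and `hnat` applies.
    · have main : ∀ q : EisensteinInt, nrm q = p → q ∣ x →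
          ∃ d : EisensteinInt, 1 < nrm d ∧ star d ^ 2 ∣ x * d := by
        intro q hq hqx
        have hqs : nrm (star q) = p := by rw [QuadraticAlgebra.norm_star, hq]
        have hqp := (irreducible_of_norm_prime hp hq).prime
        have hqsp := (irreducible_of_norm_prime hp hqs).prime
        have h1p : (1 : ℤ) < p := by exact_mod_cast hp.one_lt
        by_cases hsx : star q ∣ x
        · obtain ⟨y, rfl⟩ := hqx
          rcases hqsp.dvd_or_dvd hsx with h4 | ⟨z, rfl⟩
          · refine ⟨q, by rw [hq]; exact h1p, ?_⟩
            rw [pow_two]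
            exact mul_dvd_mul hsx h4
          · refine hnat p hp ⟨z, ?_⟩
            rw [← mul_assoc, mul_star_self, hq]
            simp
        · refine ⟨star q, by rw [hqs]; exact h1p, ?_⟩
          rw [star_star]
          have h5 : ¬ q ∣ star x := fun h => hsx (by rwa [← star_dvd_star, star_star])
          have h6 : q ^ 2 ∣ x * star x := by
            rw [mul_star_self]
            obtain ⟨k, hk⟩ := hpp
            refine ⟨star q ^ 2 * k, ?_⟩
            rw [← mul_assoc, ← mul_pow, mul_star_self, hk, hq]
            push_cast; ring
          exact (hqp.pow_dvd_of_dvd_mul_right 2 h5 h6).mul_right _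
      obtain ⟨q, hq⟩ := exists_norm_eq hp hp1
      have h4 : q ∣ x * star x := by
        rw [mul_star_self]
        obtain ⟨k, hk⟩ := hpx
        refine ⟨star q * k, ?_⟩
        rw [← mul_assoc, mul_star_self, hk, hq]
        push_cast; ring
      rcases (irreducible_of_norm_prime hp hq).prime.dvd_or_dvd h4 with h5 | h5
      · exact main q hq h5
      · rw [← star_dvd_star, star_star] at h5
        exact main (star q) (by rw [QuadraticAlgebra.norm_star, hq]) h5
    · exact hnat p hp (natCast_dvd_of_dvd_norm hp hp2 hpx)

end EisensteinInt

/-! ### The resolvent of a trace-zero element and its transformation rules -/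

section

open EisensteinInt

section Resolvent

variable {K : Type*} [Field K] [CharZero K]

/-- The quadratic relation satisfied by an element `t` of trace zero of a cyclic cubic field with
Galois group generated by `s`: the numbers `g`, `h` are the coordinates of a cubic resolvent. -/
structure IsResolvent (s : K ≃ₐ[ℚ] K) (t : K) (g h : ℚ) : Prop where
  ne_zero : t ≠ 0
  trace : t + s t + s (s t) = 0
  sq : t ^ 2 = 2 * (g ^ 2 - g * h + h ^ 2) + g * t + h * s t

variable {s : K ≃ₐ[ℚ] K} {t : K} {g h : ℚ}

theorem apply_apply_eq (htr : t + s t + s (s t) = 0) : s (s t) = - t - s t := by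
  linear_combination htr

/-- The sum of the relation and its two conjugates is 3a = 0. Eliminating s(t) from the first two
leaves (b² − bc + c²) t = 0, and this form is anisotropic over ℚ. -/
theorem coeff_eq_zero_of_trace_eq_zero (ht : t ≠ 0) (htr : t + s t + s (s t) = 0) {a b c : ℚ}
    (habc : (a : K) + b * t + c * s t = 0) : a = 0 ∧ b = 0 ∧ c = 0 := by
  have h2 := apply_apply_eq htr
  have e1 : (a : K) + b * s t + c * (-t - s t) = 0 := by
    rw [← h2]
    simpa using congrArg s habc
  have e2 : (a : K) + b * (-t - s t) + c * t = 0 := by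
    have := congrArg s e1
    simp only [map_add, map_mul, map_ratCast, map_sub, map_neg, h2, map_zero] at this
    linear_combination this
  have ha : (a : K) = 0 := by
    have : (3 : K) * a = 0 := by linear_combination habc + e1 + e2
    simpa using this
  have hbc : ((b ^ 2 - b * c + c ^ 2 : ℚ) : K) * t = 0 := by
    push_cast
    rw [ha] at habc e1 e2
    linear_combination ((b : K) - c) * habc - c * e1
  have hbc' : b ^ 2 - b * c + c ^ 2 = 0 := by
    have := (mul_eq_zero.1 hbc).resolve_right ht
    exact_mod_cast this
  have hb : b = 0 := by nlinarith [sq_nonneg (b - 2 * c), sq_nonneg b]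
  have hc : c = 0 := by rw [hb] at hbc'; simpa using hbc'
  exact ⟨by exact_mod_cast ha, hb, hc⟩

namespace IsResolvent

variable (H : IsResolvent s t g h)
include H

theorem apply_apply : s (s t) = - t - s t := apply_apply_eq H.trace

theorem sq_apply : (s t) ^ 2 = 2 * (g ^ 2 - g * h + h ^ 2) + g * s t + h * (- t - s t) := by
  have := congrArg s H.sq
  simpa [H.apply_apply, map_ofNat] using this

theorem sq_apply_apply :
    (- t - s t) ^ 2 = 2 * (g ^ 2 - g * h + h ^ 2) + g * (- t - s t) + h * t := by
  have := congrArg s H.sq_apply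
  simp only [map_pow, map_add, map_mul, map_ratCast, map_sub, map_neg, map_ofNat, H.apply_apply]
    at this
  linear_combination this

theorem mul_apply : t * s t = - (g ^ 2 - g * h + h ^ 2) + g * (- t - s t) + h * t := by
  linear_combination (H.sq_apply_apply - H.sq - H.sq_apply) / 2

/-- The cubic equation of t depends on the resolvent alone; hence the field can be recovered from
the resolvent. -/
theorem pow_three : t ^ 3 = 3 * (g ^ 2 - g * h + h ^ 2) * t +
    (g ^ 2 - g * h + h ^ 2) * (2 * g - h) := by
  linear_combination t * H.sq + g * H.sq + h * H.mul_apply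

theorem neg : IsResolvent s (-t) (-g) (-h) where
  ne_zero := neg_ne_zero.2 H.ne_zero
  trace := by simp only [map_neg]; linear_combination - H.trace
  sq := by simp only [map_neg]; push_cast; linear_combination H.sq

/-- For h = 0 the relation factors as (t − 2g)(t + g) = 0, which would make t rational. -/
theorem im_ne_zero : h ≠ 0 := by
  rintro rfl
  have e : (t - 2 * g) * (t + g) = 0 := by
    have := H.sq
    push_cast at this
    linear_combination this
  rcases mul_eq_zero.1 e with e | e
  · have := (coeff_eq_zero_of_trace_eq_zero H.ne_zero H.trace (a := -2 * g) (b := 1) (c := 0)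
      (by push_cast; linear_combination e)).2.1
    norm_num at this
  · have := (coeff_eq_zero_of_trace_eq_zero H.ne_zero H.trace (a := g) (b := 1) (c := 0)
      (by push_cast; linear_combination e)).2.1
    norm_num at this

/-- If `t` is replaced by `(u + v ω) • t`, with `ω` acting as `s`, then the resolvent `γ` is
replaced by `Γ` with `Γ * (u + v ω) = star (u + v ω) ^ 2 * γ`. -/
theorem transform {u v G J : ℚ} (huv : u ≠ 0 ∨ v ≠ 0)
    (h1 : G * u - J * v = (u ^ 2 - 2 * u * v) * g - (v ^ 2 - 2 * u * v) * h)
    (h2 : G * v + J * u - J * v = (v ^ 2 - 2 * u * v) * g + (u ^ 2 - v ^ 2) * h) :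
    IsResolvent s (u * t + v * s t) G J := by
  have hn : u ^ 2 - u * v + v ^ 2 ≠ 0 := by
    intro h0
    have hv : v ^ 2 = 0 := by nlinarith [sq_nonneg (2 * u - v), sq_nonneg v]
    have hv : v = 0 := by simpa using hv
    have hu : u = 0 := by rw [hv] at h0; simpa using h0
    rcases huv with h | h <;> contradiction
  -- N(Γ) = N(γ) N(e), by taking norms in Γ e = ē² γ and cancelling N(e).
  have h3 : G ^ 2 - G * J + J ^ 2 = (g ^ 2 - g * h + h ^ 2) * (u ^ 2 - u * v + v ^ 2) := by
    refine mul_right_cancel₀ hn ?_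
    linear_combination ((G * u - J * v) + ((u ^ 2 - 2 * u * v) * g - (v ^ 2 - 2 * u * v) * h) -
      (G * v + J * u - J * v)) * h1 + (-((u ^ 2 - 2 * u * v) * g - (v ^ 2 - 2 * u * v) * h) +
      (G * v + J * u - J * v) + ((v ^ 2 - 2 * u * v) * g + (u ^ 2 - v ^ 2) * h)) * h2
  have h1' : (G : K) * u - J * v = (u ^ 2 - 2 * u * v) * g - (v ^ 2 - 2 * u * v) * h := by
    exact_mod_cast h1
  have h2' : (G : K) * v + J * u - J * v = (v ^ 2 - 2 * u * v) * g + (u ^ 2 - v ^ 2) * h := by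
    exact_mod_cast h2
  have h3' : (G : K) ^ 2 - G * J + J ^ 2 =
      (g ^ 2 - g * h + h ^ 2) * (u ^ 2 - u * v + v ^ 2) := by
    exact_mod_cast h3
  refine ⟨fun h0 => ?_, ?_, ?_⟩
  · have := coeff_eq_zero_of_trace_eq_zero H.ne_zero H.trace (a := 0) (b := u) (c := v)
      (by push_cast; linear_combination h0)
    rcases huv with h | h
    · exact h this.2.1
    · exact h this.2.2
  · simp only [map_add, map_mul, map_ratCast, H.apply_apply, map_sub, map_neg]
    ring
  · simp only [map_add, map_mul, map_ratCast, H.apply_apply]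
    linear_combination (u : K) ^ 2 * H.sq + 2 * u * v * H.mul_apply + v ^ 2 * H.sq_apply -
      2 * h3' - t * h1' - s t * h2'

/-- Replacing the generator of the Galois group by its inverse conjugates the resolvent. -/
theorem conj (s' : K ≃ₐ[ℚ] K) (hs' : ∀ x, s' x = s (s x)) (hs3 : ∀ x, s (s (s x)) = x) :
    IsResolvent s' t (g - h) (-h) where
  ne_zero := H.ne_zero
  trace := by rw [hs', hs', hs3]; linear_combination H.trace
  sq := by rw [hs', H.apply_apply]; push_cast; linear_combination H.sq

end IsResolvent

end Resolvent

end

/-! ### Existence and uniqueness of the reduced resolvent of a cubic field -/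

section

open EisensteinInt

section Cubic

namespace IsResolvent

variable {K : Type*} [Field K] [CharZero K] {s : K ≃ₐ[ℚ] K} {t : K}

/-- Converse of `transform`: coordinates with respect to 1, t, s(t) are unique. -/
theorem eq_of_transform {g h u v G J : ℚ} (H : IsResolvent s t g h)
    (H' : IsResolvent s (u * t + v * s t) G J) :
    G * u - J * v = (u ^ 2 - 2 * u * v) * g - (v ^ 2 - 2 * u * v) * h ∧
    G * v + J * u - J * v = (v ^ 2 - 2 * u * v) * g + (u ^ 2 - v ^ 2) * h := by
  have hsq := H'.sq
  simp only [map_add, map_mul, map_ratCast, H.apply_apply] at hsq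
  obtain ⟨-, h1, h2⟩ := coeff_eq_zero_of_trace_eq_zero H.ne_zero H.trace
    (a := 2 * (G ^ 2 - G * J + J ^ 2) - 2 * (g ^ 2 - g * h + h ^ 2) * (u ^ 2 - u * v + v ^ 2))
    (b := G * u - J * v - ((u ^ 2 - 2 * u * v) * g - (v ^ 2 - 2 * u * v) * h))
    (c := G * v + J * u - J * v - ((v ^ 2 - 2 * u * v) * g + (u ^ 2 - v ^ 2) * h))
    (by
      push_cast
      linear_combination (u : K) ^ 2 * H.sq + 2 * u * v * H.mul_apply + v ^ 2 * H.sq_apply - hsq)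
  exact ⟨by linarith, by linarith⟩

theorem transform_eisensteinInt {x y e : EisensteinInt} {n : ℤ}
    (H : IsResolvent s t x.re x.im) (he : e ≠ 0) (hn : n ≠ 0)
    (h : y * e * (n : EisensteinInt) = star e ^ 2 * x) :
    IsResolvent s ((e.re / n : ℚ) * t + (e.im / n : ℚ) * s t) y.re y.im := by
  have hn' : (n : ℚ) ≠ 0 := by exact_mod_cast hn
  refine H.transform ?_ ?_ ?_
  · by_contra! hc
    simp only [div_eq_zero_iff, hn', or_false, Int.cast_eq_zero] at hc
    exact he (QuadraticAlgebra.ext hc.1 hc.2)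
  · have h1 := congrArg QuadraticAlgebra.re h
    simp only [pow_two, QuadraticAlgebra.re_mul, QuadraticAlgebra.im_mul,
        QuadraticAlgebra.re_star, QuadraticAlgebra.im_star, QuadraticAlgebra.re_intCast,
        QuadraticAlgebra.im_intCast] at h1
    have h2 := congrArg (Int.cast : ℤ → ℚ) h1
    push_cast at h2
    field_simp
    linear_combination h2
  · have h1 := congrArg QuadraticAlgebra.im h
    simp only [pow_two, QuadraticAlgebra.re_mul, QuadraticAlgebra.im_mul,
        QuadraticAlgebra.re_star, QuadraticAlgebra.im_star, QuadraticAlgebra.re_intCast,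
        QuadraticAlgebra.im_intCast] at h1
    have h2 := congrArg (Int.cast : ℤ → ℚ) h1
    push_cast at h2
    field_simp
    linear_combination h2

end IsResolvent

variable {K : Type*} [Field K] [CharZero K]

section

variable (hK : Module.finrank ℚ K = 3) {s : K ≃ₐ[ℚ] K} {t : K}
include hK

theorem exists_coeff_of_trace_eq_zero (ht : t ≠ 0) (htr : t + s t + s (s t) = 0) (z : K) :
    ∃ a b c : ℚ, z = a + b * t + c * s t := by
  have hli : LinearIndependent ℚ ![1, t, s t] := by
    rw [Fintype.linearIndependent_iff]
    intro f hf
    rw [Fin.sum_univ_three] at hf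
    simp only [Matrix.cons_val_zero, Matrix.cons_val_one, Matrix.cons_val, Algebra.smul_def,
      eq_ratCast, mul_one] at hf
    obtain ⟨h0, h1, h2⟩ := coeff_eq_zero_of_trace_eq_zero ht htr hf
    intro i
    fin_cases i <;> assumption
  have : FiniteDimensional ℚ K := FiniteDimensional.of_finrank_pos (by omega)
  have hspan := hli.span_eq_top_of_card_eq_finrank' (by rw [hK]; rfl)
  have hz : z ∈ Submodule.span ℚ (Set.range ![1, t, s t]) := by rw [hspan]; trivial
  rw [Submodule.mem_span_range_iff_exists_fun] at hz
  obtain ⟨c, hc⟩ := hz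
  refine ⟨c 0, c 1, c 2, ?_⟩
  rw [← hc, Fin.sum_univ_three]
  simp [Algebra.smul_def]

/-- Expand t² = c + g t + h s(t). Computing t · t · s(t) in two ways, through t · s(t) and through
t², forces c = 2(g² − gh + h²). -/
theorem exists_isResolvent_rat (ht : t ≠ 0) (htr : t + s t + s (s t) = 0) :
    ∃ g h : ℚ, IsResolvent s t g h := by
  obtain ⟨c, g, h, hsq⟩ := exists_coeff_of_trace_eq_zero hK ht htr (t ^ 2)
  have h2 := apply_apply_eq htr
  have hsq1 : (s t) ^ 2 = c + g * s t + h * (- t - s t) := by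
    have := congrArg s hsq
    simpa [h2] using this
  have hsq2 : (- t - s t) ^ 2 = c + g * (- t - s t) + h * t := by
    have := congrArg s hsq1
    simp only [map_pow, map_add, map_mul, map_ratCast, map_sub, map_neg, h2] at this
    linear_combination this
  have hmul : t * s t = - c / 2 + g * (- t - s t) + h * t := by
    linear_combination (hsq2 - hsq - hsq1) / 2
  have key : ((0 : ℚ) : K) + ((c / 2 - (g ^ 2 - g * h + h ^ 2) : ℚ) : K) * t +
      ((c - 2 * (g ^ 2 - g * h + h ^ 2)  : ℚ) : K) * s t = 0 := by
    push_cast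
    linear_combination t * hmul - s t * hsq - 2 * g * hmul - h * hsq1 - (g - h) * hsq
  have hc := (coeff_eq_zero_of_trace_eq_zero ht htr key).2.1
  refine ⟨g, h, ht, htr, ?_⟩
  have : (c : K) = 2 * (g ^ 2 - g * h + h ^ 2) := by
    have : c = 2 * (g ^ 2 - g * h + h ^ 2) := by linarith
    exact_mod_cast this
  rw [hsq, this]

/-- Both elements have trace zero, so t' is a multiple of t by some e/n, with e in ℤ[ω] and n the
product of the denominators. Then y e n = ē² x, and taking norms turns this into y N(y) n³ = x N(x)
ē³, to which `IsReduced.eq_or_eq_neg` applies. -/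
theorem resolvent_unique {s : K ≃ₐ[ℚ] K} {t t' : K} {x y : EisensteinInt} (hx : x.IsReduced)
    (hy : y.IsReduced) (H : IsResolvent s t x.re x.im) (H' : IsResolvent s t' y.re y.im) :
    y = x ∨ y = -x := by
  obtain ⟨a, u, v, hauv⟩ := exists_coeff_of_trace_eq_zero hK H.ne_zero H.trace t'
  have h2 := H.apply_apply
  have ha : a = 0 := by
    have := H'.trace
    rw [hauv] at this
    simp only [map_add, map_mul, map_ratCast, H.apply_apply, map_sub, map_neg] at this
    have h3 : (3 : K) * a = 0 := by linear_combination this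
    have h4 : (a : K) = 0 := by simpa using h3
    exact_mod_cast h4
  rw [ha, Rat.cast_zero, zero_add] at hauv
  rw [hauv] at H'
  obtain ⟨h1, h2⟩ := H.eq_of_transform H'
  have hd : u.den * v.den ≠ 0 := by positivity
  set e : EisensteinInt := ⟨u.num * v.den, v.num * u.den⟩ with he
  set n : EisensteinInt := ((u.den * v.den : ℕ) : EisensteinInt) with hn
  have hn0 : n ≠ 0 := by rw [hn]; exact_mod_cast hd
  have hun : u * u.den = u.num := Rat.mul_den_eq_num u
  have hvn : v * v.den = v.num := Rat.mul_den_eq_num v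
  have hre : (e.re : ℚ) = u * (u.den * v.den : ℕ) := by
    rw [he]; push_cast; rw [← hun]; ring
  have him : (e.im : ℚ) = v * (u.den * v.den : ℕ) := by
    rw [he]; push_cast; rw [← hvn]; ring
  have key : y * e * n = star e ^ 2 * x := by
    rw [hn]
    generalize u.den * v.den = m at hre him
    clear_value e
    ext
    · simp only [pow_two, QuadraticAlgebra.re_mul, QuadraticAlgebra.im_mul,
        QuadraticAlgebra.re_star, QuadraticAlgebra.im_star, QuadraticAlgebra.re_natCast,
        QuadraticAlgebra.im_natCast]
      have : ((y.re * e.re - y.im * e.im) * m : ℚ) =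
          (e.re ^ 2 - 2 * e.re * e.im) * x.re - (e.im ^ 2 - 2 * e.re * e.im) * x.im := by
        rw [hre, him]
        linear_combination (m : ℚ) ^ 2 * h1
      have : (y.re * e.re - y.im * e.im) * m =
          (e.re ^ 2 - 2 * e.re * e.im) * x.re - (e.im ^ 2 - 2 * e.re * e.im) * x.im := by
        exact_mod_cast this
      linear_combination this
    · simp only [pow_two, QuadraticAlgebra.re_mul, QuadraticAlgebra.im_mul,
        QuadraticAlgebra.re_star, QuadraticAlgebra.im_star, QuadraticAlgebra.re_natCast,
        QuadraticAlgebra.im_natCast]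
      have : ((y.re * e.im + y.im * e.re - y.im * e.im) * m : ℚ) =
          (e.im ^ 2 - 2 * e.re * e.im) * x.re + (e.re ^ 2 - e.im ^ 2) * x.im := by
        rw [hre, him]
        linear_combination (m : ℚ) ^ 2 * h2
      have : (y.re * e.im + y.im * e.re - y.im * e.im) * m =
          (e.im ^ 2 - 2 * e.re * e.im) * x.re + (e.re ^ 2 - e.im ^ 2) * x.im := by
        exact_mod_cast this
      linear_combination this
  have he0 : e ≠ 0 := by
    intro h0
    rw [h0, star_zero, mul_zero, zero_mul, zero_pow two_ne_zero, zero_mul] at key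
    have h3 : (u : ℚ) = 0 ∧ v = 0 := by
      rw [h0] at hre him
      have hd' : ((u.den * v.den : ℕ) : ℚ) ≠ 0 := by exact_mod_cast hd
      constructor
      · exact (mul_eq_zero.1 (by simpa using hre.symm)).resolve_right hd'
      · exact (mul_eq_zero.1 (by simpa using him.symm)).resolve_right hd'
    exact H'.ne_zero (by simp [h3])
  refine hx.eq_or_eq_neg hy hn0 (d := star e) (mul_left_cancel₀ he0 ?_)
  have hnn : (nrm y : EisensteinInt) * n ^ 2 = (nrm x : EisensteinInt) * (e * star e) := by
    rw [mul_star_self]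
    have h5 := congrArg nrm key
    have h6 : nrm n = ((u.den * v.den : ℕ) : ℤ) ^ 2 := by rw [hn, QuadraticAlgebra.norm_natCast]
    simp only [map_mul, map_pow, QuadraticAlgebra.norm_star, h6] at h5
    have h7 : nrm y * ((u.den * v.den : ℕ) : ℤ) ^ 2 = nrm x * nrm e := by
      refine mul_right_cancel₀ (norm_pos he0).ne' ?_
      linear_combination h5
    rw [hn]
    exact_mod_cast congrArg (Int.cast : ℤ → EisensteinInt) h7
  linear_combination (nrm y : EisensteinInt) * n ^ 2 * key + star e ^ 2 * x * hnn

end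

variable (hK : Module.finrank ℚ K = 3) [IsGalois ℚ K]
include hK

theorem card_galois_eq_three : Nat.card (K ≃ₐ[ℚ] K) = 3 := by
  have : FiniteDimensional ℚ K := FiniteDimensional.of_finrank_pos (by omega)
  rw [IsGalois.card_aut_eq_finrank, hK]

theorem galois_pow_three (s : K ≃ₐ[ℚ] K) (x : K) : s (s (s x)) = x := by
  have h : s ^ 3 = 1 := by rw [← card_galois_eq_three hK]; exact pow_card_eq_one'
  have := congrArg (fun f : K ≃ₐ[ℚ] K => f x) h
  simpa [pow_succ] using this

theorem exists_galois_ne_one : ∃ s : K ≃ₐ[ℚ] K, s ≠ 1 := by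
  have : FiniteDimensional ℚ K := FiniteDimensional.of_finrank_pos (by omega)
  have : Nontrivial (K ≃ₐ[ℚ] K) := by
    rw [← Finite.one_lt_card_iff_nontrivial, card_galois_eq_three hK]
    norm_num
  exact exists_ne 1

theorem galois_eq_or {s s' : K ≃ₐ[ℚ] K} (hs : s ≠ 1) (hs' : s' ≠ 1) :
    s' = s ∨ ∀ x, s' x = s (s x) := by
  have : FiniteDimensional ℚ K := FiniteDimensional.of_finrank_pos (by omega)
  have : Fact (Nat.Prime 3) := ⟨Nat.prime_three⟩
  have hcard := card_galois_eq_three hK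
  have hmem := mem_zpowers_of_prime_card hcard hs (g' := s')
  have ho : orderOf s = 3 := by
    have h1 := orderOf_dvd_natCard s
    rw [hcard, Nat.dvd_prime Nat.prime_three] at h1
    exact h1.resolve_left fun h => hs (orderOf_eq_one_iff.1 h)
  obtain ⟨k, hk⟩ := hmem
  simp only at hk
  rw [← zpow_mod_orderOf, ho] at hk
  rcases (by omega : k % 3 = 0 ∨ k % 3 = 1 ∨ k % 3 = 2) with h | h | h
  · exact absurd (by rw [← hk]; simp [h]) hs'
  · left; rw [← hk]; simp [h]
  · right
    intro x
    rw [← hk]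
    simp only [Nat.cast_ofNat, h]
    rfl

/-- An integral resolvent of least norm is reduced: otherwise `exists_star_sq_dvd` supplies d such
that dividing t by d gives the integral resolvent x d / d̄², whose norm is smaller by the factor
N(d) > 1. -/
theorem exists_reduced_isResolvent (s : K ≃ₐ[ℚ] K) (hs : s ≠ 1) :
    ∃ (t : K) (x : EisensteinInt), x.IsReduced ∧ IsResolvent s t x.re x.im := by
  obtain ⟨z, hz⟩ : ∃ z, s z ≠ z := by
    by_contra! hc
    exact hs (AlgEquiv.ext hc)
  obtain ⟨g, h, H⟩ := exists_isResolvent_rat hK (s := s) (t := z - s z)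
    (sub_ne_zero.2 hz.symm) (by simp only [map_sub, galois_pow_three hK]; ring)
  have hne : ∃ (n : ℕ) (t : K) (x : EisensteinInt), (nrm x = n) ∧ IsResolvent s t x.re x.im := by
    have hd : (g.den : ℚ) * h.den ≠ 0 := by
      have := g.den_ne_zero
      have := h.den_ne_zero
      positivity
    have hgn : g * g.den = g.num := Rat.mul_den_eq_num g
    have hhn : h * h.den = h.num := Rat.mul_den_eq_num h
    -- A rational multiplier just scales the resolvent, so denominators can be cleared.
    have H' := H.transform (u := g.den * h.den) (v := 0)
      (G := (g.num * h.den : ℤ)) (J := (h.num * g.den : ℤ)) (Or.inl hd)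
      (by push_cast; linear_combination (-(g.den * h.den ^ 2 : ℚ)) * hgn)
      (by push_cast; linear_combination (-(g.den ^ 2 * h.den : ℚ)) * hhn)
    refine ⟨(nrm (⟨g.num * h.den, h.num * g.den⟩ : EisensteinInt)).toNat, _,
      ⟨g.num * h.den, h.num * g.den⟩, ?_, H'⟩
    rw [Int.toNat_of_nonneg (norm_nonneg _)]
  classical
  obtain ⟨t, x, hx, hxt⟩ := Nat.find_spec hne
  refine ⟨t, x, ?_, hxt⟩
  by_contra hred
  have hx0 : x ≠ 0 := by
    rintro rfl
    exact hxt.im_ne_zero (by simp)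
  obtain ⟨d, hd1, y, hy⟩ := exists_star_sq_dvd hx0 hred
  have hyn : nrm y * nrm d = nrm x := by
    have := congrArg nrm hy
    simp only [map_mul, map_pow, QuadraticAlgebra.norm_star] at this
    have hd0 : nrm d ≠ 0 := by omega
    exact mul_right_cancel₀ hd0 (by linear_combination -this)
  have hy0 := norm_nonneg y
  have hx1 := norm_pos hx0
  -- The multiplier is 1/d, written as d̄ / N(d).
  refine Nat.find_min hne (m := (nrm y).toNat) ?_
    ⟨_, y, by rw [Int.toNat_of_nonneg hy0], hxt.transform_eisensteinInt (e := star d) (n := nrm d)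
      (star_ne_zero.2 fun h => by simp [h] at hd1) (by omega) ?_⟩
  · zify
    rw [Int.toNat_of_nonneg hy0, ← hx]
    nlinarith
  · rw [star_star, ← mul_star_self]
    linear_combination (-d) * hy

end Cubic

end

/-! ### The resolvent cubic and the correspondence between fields and reduced elements -/

section

open EisensteinInt Polynomial

/-- The cubic polynomial `X ^ 3 - 3 n X - n (2 g - h)`, where `n` is the norm of `g + h ω`. -/
noncomputable def resolventCubic (x : EisensteinInt) : ℤ[X] :=
  Cubic.toPoly ⟨1, 0, -3 * nrm x, -(nrm x * (2 * x.re - x.im))⟩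

theorem resolventCubic_monic (x : EisensteinInt) : (resolventCubic x).Monic :=
  Cubic.monic_of_a_eq_one rfl

theorem resolventCubic_natDegree (x : EisensteinInt) : (resolventCubic x).natDegree = 3 :=
  Cubic.natDegree_of_a_ne_zero' one_ne_zero

theorem aeval_resolventCubic {A : Type*} [CommRing A] (x : EisensteinInt) (t : A) :
    aeval t (resolventCubic x) =
      t ^ 3 - 3 * (nrm x : A) * t - (nrm x : A) * (2 * (x.re : A) - x.im) := by
  simp [resolventCubic, Cubic.toPoly, map_ofNat]
  ring

namespace EisensteinInt

theorem IsReduced.eq_or_of_nrm_eq_one {x : EisensteinInt} (h : nrm x = 1) (him : x.im ≠ 0) :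
    2 * x.re - x.im = 1 ∨ 2 * x.re - x.im = -1 := by
  have h4 := four_mul_norm x
  have h1 : 0 < x.im ^ 2 := by positivity
  have h2 : (2 * x.re - x.im) ^ 2 ≤ 1 := by linarith
  have h3 : 2 * x.re - x.im ≠ 0 := by
    intro h0
    rw [h0, h] at h4
    omega
  have := abs_le.1 ((sq_le_one_iff_abs_le_one _).1 h2)
  omega

theorem IsReduced.not_dvd_trace {x : EisensteinInt} (hx : IsReduced x) {p : ℕ} (hp : p.Prime)
    (hpx : (p : ℤ) ∣ nrm x) : ¬ (p : ℤ) ∣ 2 * x.re - x.im := by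
  intro h
  have hpp := Nat.prime_iff_prime_int.1 hp
  have h4 : (p : ℤ) ∣ 3 * x.im ^ 2 := by
    have : 3 * x.im ^ 2 = 4 * nrm x - (2 * x.re - x.im) * (2 * x.re - x.im) := by
      rw [four_mul_norm]; ring
    rw [this]
    exact dvd_sub (hpx.mul_left _) (h.mul_left _)
  rcases hpp.dvd_or_dvd h4 with h5 | h5
  · have : p = 3 := (Nat.prime_dvd_prime_iff_eq hp Nat.prime_three).1 (by exact_mod_cast h5)
    subst this
    exact hx.2 hpx
  · have h6 := hpp.dvd_of_dvd_pow h5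
    have h7 : (p : ℤ) ∣ x.re := by
      refine hpp.dvd_of_dvd_pow (n := 2) ?_
      have : x.re ^ 2 = nrm x - (x.im - x.re) * x.im := by rw [norm_eq]; ring
      rw [this]
      exact dvd_sub hpx (h6.mul_left _)
    obtain ⟨a, ha⟩ := h6
    obtain ⟨b, hb⟩ := h7
    have : (p : ℤ) * p ∣ nrm x := ⟨b ^ 2 - b * a + a ^ 2, by rw [norm_eq, ha, hb]; ring⟩
    exact hpp.not_isUnit (hx.1 _ this)

/-- An integer root is excluded. If n > 1, the cubic is Eisenstein at any prime p ∣ n, since p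
exactly divides n and p ∤ 2g − h. If n = 1, a root r would satisfy r(r² − 3) = ±1. -/
theorem IsReduced.irreducible_resolventCubic {x : EisensteinInt} (hx : IsReduced x)
    (him : x.im ≠ 0) : Irreducible (resolventCubic x) := by
  rw [(resolventCubic_monic x).irreducible_iff_roots_eq_zero_of_degree_le_three
    (by rw [resolventCubic_natDegree]; norm_num) (by rw [resolventCubic_natDegree]),
    Multiset.eq_zero_iff_forall_notMem]
  intro n hn
  rw [mem_roots (resolventCubic_monic x).ne_zero, IsRoot.def, ← coe_aeval_eq_eval,
    aeval_resolventCubic] at hn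
  simp only [Int.cast_id] at hn
  by_cases h1 : nrm x = 1
  · rw [h1] at hn
    have h2 : n * (n ^ 2 - 3) = 2 * x.re - x.im := by linarith
    have h3 : IsUnit (n * (n ^ 2 - 3)) := by
      rw [h2, Int.isUnit_iff]
      exact IsReduced.eq_or_of_nrm_eq_one h1 him
    rcases Int.isUnit_iff.1 (isUnit_of_mul_isUnit_left h3) with rfl | rfl <;>
    · have := Int.isUnit_iff.1 (isUnit_of_mul_isUnit_right h3)
      norm_num at this
  · obtain ⟨p, hp, hpd⟩ := Nat.exists_prime_and_dvd (n := (nrm x).natAbs) (by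
      have := norm_nonneg x
      omega)
    have hpd : (p : ℤ) ∣ nrm x := Int.natCast_dvd.2 hpd
    have hpp := Nat.prime_iff_prime_int.1 hp
    obtain ⟨k, hk⟩ : (p : ℤ) ∣ n := by
      refine hpp.dvd_of_dvd_pow (n := 3) ?_
      have : n ^ 3 = nrm x * (3 * n + (2 * x.re - x.im)) := by linarith
      rw [this]
      exact hpd.mul_right _
    obtain ⟨f, hf⟩ := hpd
    have hpf : ¬ (p : ℤ) ∣ f := by
      rintro ⟨f', rfl⟩
      exact hpp.not_isUnit (hx.1 p ⟨f', by rw [hf]; ring⟩)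
    have h5 : (p : ℤ) ∣ f * (2 * x.re - x.im) := by
      refine ⟨p * k ^ 3 - 3 * f * k, mul_left_cancel₀ hpp.ne_zero ?_⟩
      rw [hf, hk] at hn
      linear_combination -hn
    rcases hpp.dvd_or_dvd h5 with h6 | h6
    · exact hpf h6
    · exact hx.not_dvd_trace hp ⟨f, hf⟩ h6

theorem IsReduced.irreducible_map {x : EisensteinInt} (hx : IsReduced x) (him : x.im ≠ 0) :
    Irreducible ((resolventCubic x).map (algebraMap ℤ ℚ)) :=
  ((resolventCubic_monic x).irreducible_iff_irreducible_map_fraction_map).1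
    (hx.irreducible_resolventCubic him)

end EisensteinInt

/-- The cubic field generated by a root of the resolvent cubic. -/
abbrev ResolventField (x : EisensteinInt) : Type :=
  AdjoinRoot ((resolventCubic x).map (algebraMap ℤ ℚ))

namespace IsResolvent

variable {K : Type*} [Field K] [CharZero K] {s : K ≃ₐ[ℚ] K} {t : K} {x : EisensteinInt}

theorem aeval_eq_zero (H : IsResolvent s t x.re x.im) : aeval t (resolventCubic x) = 0 := by
  rw [aeval_resolventCubic, norm_eq]
  have := H.pow_three
  push_cast at this ⊢
  linear_combination this

theorem nonempty_algEquiv (H : IsResolvent s t x.re x.im) (hx : x.IsReduced)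
    (hK : Module.finrank ℚ K = 3) : Nonempty (ResolventField x ≃ₐ[ℚ] K) := by
  have him : x.im ≠ 0 := by exact_mod_cast H.im_ne_zero
  have : Fact (Irreducible ((resolventCubic x).map (algebraMap ℤ ℚ))) := ⟨hx.irreducible_map him⟩
  have hmon : ((resolventCubic x).map (algebraMap ℤ ℚ)).Monic := (resolventCubic_monic x).map _
  let f : ResolventField x →ₐ[ℚ] K := AdjoinRoot.liftAlgHom _ (Algebra.ofId ℚ K) t (by
    have := H.aeval_eq_zero
    rw [aeval_def] at this
    rw [eval₂_map, ← this]
    congr 1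
    exact Subsingleton.elim _ _)
  have hf : Module.finrank ℚ (ResolventField x) = 3 := by
    rw [(AdjoinRoot.powerBasis hmon.ne_zero).finrank, AdjoinRoot.powerBasis_dim,
      (resolventCubic_monic x).natDegree_map, resolventCubic_natDegree]
  have : FiniteDimensional ℚ K := FiniteDimensional.of_finrank_pos (by omega)
  have : FiniteDimensional ℚ (ResolventField x) := FiniteDimensional.of_finrank_pos (by omega)
  have hinj : Function.Injective f := f.toRingHom.injective
  exact ⟨AlgEquiv.ofBijective f ⟨hinj,
    (LinearMap.injective_iff_surjective_of_finrank_eq_finrank (f := f.toLinearMap)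
      (hf.trans hK.symm)).1 hinj⟩⟩

theorem ne_one {g h : ℚ} (H : IsResolvent s t g h) : s ≠ 1 := by
  rintro rfl
  have := H.trace
  simp only [AlgEquiv.one_apply] at this
  have h3 : (3 : K) * t = 0 := by linear_combination this
  exact H.ne_zero (by simpa using h3)

end IsResolvent

theorem finrank_resolventField (x : EisensteinInt) :
    Module.finrank ℚ (ResolventField x) = 3 := by
  have hmon : ((resolventCubic x).map (algebraMap ℤ ℚ)).Monic := (resolventCubic_monic x).map _
  rw [(AdjoinRoot.powerBasis hmon.ne_zero).finrank, AdjoinRoot.powerBasis_dim,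
      (resolventCubic_monic x).natDegree_map, resolventCubic_natDegree]

/-- The relation for t², solved for s(t), gives r = (t² − 2n − g t)/h. This is again a root of the
cubic, so t ↦ r defines an automorphism, and t + r + s(r) = 0 gives s³ = 1. -/
theorem exists_isResolvent_resolventField {x : EisensteinInt} (hx : x.IsReduced) (him : x.im ≠ 0)
    [Fact (Irreducible ((resolventCubic x).map (algebraMap ℤ ℚ)))] :
    ∃ (s : ResolventField x ≃ₐ[ℚ] ResolventField x) (t : ResolventField x),
      IsResolvent s t x.re x.im ∧ ∀ y, s (s (s y)) = y := by
  have hf := finrank_resolventField x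
  have : FiniteDimensional ℚ (ResolventField x) := FiniteDimensional.of_finrank_pos (by omega)
  have halg : ∀ z : ResolventField x,
      eval₂ (Algebra.ofId ℚ (ResolventField x)) z ((resolventCubic x).map (algebraMap ℤ ℚ)) =
        z ^ 3 - 3 * (nrm x : ResolventField x) * z -
          (nrm x : ResolventField x) * (2 * (x.re : ResolventField x) - x.im) := by
    intro z
    rw [eval₂_map]
    simp only [resolventCubic, Cubic.toPoly, eval₂_add, eval₂_mul, eval₂_C, eval₂_pow, eval₂_X,
      eq_intCast (RingHom.comp _ (algebraMap ℤ ℚ))]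
    push_cast
    ring
  set t : ResolventField x := AdjoinRoot.root _ with ht
  obtain ⟨g, hg⟩ : ∃ g : ResolventField x, g = x.re := ⟨_, rfl⟩
  obtain ⟨h, hh⟩ : ∃ h : ResolventField x, h = x.im := ⟨_, rfl⟩
  have hn : (nrm x : ResolventField x) = g ^ 2 - g * h + h ^ 2 := by
    rw [norm_eq, hg, hh]; push_cast; ring
  have hh0 : h ≠ 0 := by rw [hh]; exact_mod_cast him
  have ht3 : t ^ 3 - 3 * (g ^ 2 - g * h + h ^ 2) * t -
      (g ^ 2 - g * h + h ^ 2) * (2 * g - h) = 0 := by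
    have h1 := halg t
    rw [show eval₂ (Algebra.ofId ℚ (ResolventField x)) t
      ((resolventCubic x).map (algebraMap ℤ ℚ)) = 0 from AdjoinRoot.eval₂_root _, hn, ← hg, ← hh] at h1
    exact h1.symm
  obtain ⟨r, hr⟩ : ∃ r : ResolventField x, h * r = t ^ 2 - 2 * (g ^ 2 - g * h + h ^ 2) - g * t :=
    ⟨(t ^ 2 - 2 * (g ^ 2 - g * h + h ^ 2) - g * t) / h, mul_div_cancel₀ _ hh0⟩
  have hr3 : eval₂ (Algebra.ofId ℚ (ResolventField x)) r
      ((resolventCubic x).map (algebraMap ℤ ℚ)) = 0 := by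
    rw [halg, hn, ← hg, ← hh]
    refine (mul_eq_zero.1 ?_).resolve_left (pow_ne_zero 3 hh0)
    generalize hS : t ^ 2 - 2 * (g ^ 2 - g * h + h ^ 2) - g * t = S at hr
    linear_combination ((h * r) ^ 2 + h * r * S + S ^ 2 - 3 * (g ^ 2 - g * h + h ^ 2) * h ^ 2) * hr -
      ((S ^ 2 + S * (t ^ 2 - 2 * (g ^ 2 - g * h + h ^ 2) - g * t) +
        (t ^ 2 - 2 * (g ^ 2 - g * h + h ^ 2) - g * t) ^ 2) -
        3 * (g ^ 2 - g * h + h ^ 2) * h ^ 2) * hS +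
      (t ^ 3 - 3 * g * t ^ 2 + (3 * g ^ 2 - 3 * (g ^ 2 - g * h + h ^ 2)) * t +
        (- g ^ 3 + 3 * g * (g ^ 2 - g * h + h ^ 2) +
          (g ^ 2 - g * h + h ^ 2) * (2 * g - h))) * ht3
  let f : ResolventField x →ₐ[ℚ] ResolventField x :=
    AdjoinRoot.liftAlgHom _ (Algebra.ofId ℚ _) r hr3
  let s : ResolventField x ≃ₐ[ℚ] ResolventField x := AlgEquiv.ofBijective f f.bijective
  have hst : s t = r := by
    exact AdjoinRoot.liftAlgHom_root _ _ _ hr3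
  have htr : t + r + s r = 0 := by
    have h1 : h * s r = r ^ 2 - 2 * (g ^ 2 - g * h + h ^ 2) - g * r := by
      have := congrArg s hr
      rw [hg, hh] at this ⊢
      simpa [hst, map_ofNat] using this
    refine (mul_eq_zero.1 ?_).resolve_left (pow_ne_zero 3 hh0)
    linear_combination h ^ 2 * h1 + (h * r +
      (t ^ 2 - 2 * (g ^ 2 - g * h + h ^ 2) - g * t) + h ^ 2 - g * h) * hr + (t - 2 * g) * ht3
  have hsr : s r = - t - r := by linear_combination htr
  refine ⟨s, t, ⟨?_, by rw [hst]; exact htr, ?_⟩, ?_⟩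
  · intro h0
    rw [h0] at ht3
    have h1 : (nrm x : ResolventField x) * (2 * (x.re : ResolventField x) - x.im) = 0 := by
      rw [hn, ← hg, ← hh]; linear_combination -ht3
    have h2 : nrm x * (2 * x.re - x.im) = 0 := by exact_mod_cast h1
    have h3 := (mul_eq_zero.1 h2).resolve_left hx.ne_zero
    have h4 := four_mul_norm x
    rw [h3] at h4
    exact hx.2 (by omega)
  · rw [hst]
    push_cast
    rw [← hg, ← hh]
    linear_combination -hr
  · have h3 : ((s : ResolventField x →ₐ[ℚ] ResolventField x).comp
        ((s : ResolventField x →ₐ[ℚ] ResolventField x).comp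
        (s : ResolventField x →ₐ[ℚ] ResolventField x))) = AlgHom.id ℚ _ := by
      refine AdjoinRoot.algHom_ext ?_
      change s (s (s t)) = t
      rw [hst, hsr, map_sub, map_neg, hsr, hst]
      ring
    exact fun y => congrArg (fun f : ResolventField x →ₐ[ℚ] ResolventField x => f y) h3

/-- There are at most three automorphisms and s has order 3, so s generates a group as large as the
degree. -/
theorem isAbelianGalois_of_pow_three {K : Type*} [Field K] [Algebra ℚ K]
    (hK : Module.finrank ℚ K = 3) {s : K ≃ₐ[ℚ] K} (hs : s ≠ 1) (hs3 : ∀ y, s (s (s y)) = y) :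
    IsAbelianGalois ℚ K := by
  classical
  have : FiniteDimensional ℚ K := FiniteDimensional.of_finrank_pos (by omega)
  have : Fact (Nat.Prime 3) := ⟨Nat.prime_three⟩
  have h3 : s ^ 3 = 1 := AlgEquiv.ext hs3
  have ho : orderOf s = 3 := orderOf_eq_prime h3 hs
  have hcard : Nat.card (K ≃ₐ[ℚ] K) = 3 := by
    refine le_antisymm ?_ ?_
    · rw [Nat.card_eq_fintype_card, ← hK]
      exact AlgEquiv.card_le
    · rw [← ho]
      exact Nat.le_of_dvd Nat.card_pos (orderOf_dvd_natCard s)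
  have hgal : IsGalois ℚ K := IsGalois.of_card_aut_eq_finrank ℚ K (hcard.trans hK.symm)
  have hcyc : IsCyclic (K ≃ₐ[ℚ] K) := isCyclic_of_prime_card hcard
  exact { toIsGalois := hgal, toIsMulCommutative := inferInstance }

namespace AbelianCubicField

/-- An abelian cubic field and an Eisenstein integer that is a resolvent of it. -/
def Attached (F : AbelianCubicField) (x : EisensteinInt) : Prop :=
  ∃ (s : F.carrier ≃ₐ[ℚ] F.carrier) (t : F.carrier), IsResolvent s t x.re x.im

instance (F : AbelianCubicField) : IsAbelianGalois ℚ F.carrier := F.isAbelian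

theorem exists_attached (F : AbelianCubicField) :
    ∃ x : EisensteinInt, x.IsReduced ∧ x.im ≠ 0 ∧ F.Attached x := by
  obtain ⟨s, hs⟩ := exists_galois_ne_one (K := F.carrier) F.finrank_eq
  obtain ⟨t, x, hx, H⟩ := exists_reduced_isResolvent F.finrank_eq s hs
  exact ⟨x, hx, by exact_mod_cast H.im_ne_zero, s, t, H⟩

theorem exists_field_attached {x : EisensteinInt} (hx : x.IsReduced) (him : x.im ≠ 0) :
    ∃ F : AbelianCubicField, F.Attached x := by
  have : Fact (Irreducible ((resolventCubic x).map (algebraMap ℤ ℚ))) := ⟨hx.irreducible_map him⟩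
  obtain ⟨s, t, H, hs3⟩ := exists_isResolvent_resolventField hx him
  have hf := finrank_resolventField x
  have : FiniteDimensional ℚ (ResolventField x) := FiniteDimensional.of_finrank_pos (by omega)
  have : NumberField (ResolventField x) := { }
  exact ⟨{ carrier := ResolventField x
           finrank_eq := hf
           isAbelian := isAbelianGalois_of_pow_three hf H.ne_one hs3 }, s, t, H⟩

theorem Attached.equiv {F G : AbelianCubicField} {x : EisensteinInt} (hx : x.IsReduced)
    (hF : F.Attached x) (hG : G.Attached x) : F ≈ G := by
  obtain ⟨s, t, H⟩ := hF
  obtain ⟨s', t', H'⟩ := hG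
  obtain ⟨e⟩ := H.nonempty_algEquiv hx F.finrank_eq
  obtain ⟨e'⟩ := H'.nonempty_algEquiv hx G.finrank_eq
  exact ⟨e.symm.trans e'⟩

theorem Attached.of_equiv {F G : AbelianCubicField} {x : EisensteinInt}
    (hF : F.Attached x) (h : F ≈ G) : G.Attached x := by
  obtain ⟨s, t, H⟩ := hF
  obtain ⟨e⟩ := h
  refine ⟨(e.symm.trans s).trans e, e t, ⟨by simpa using H.ne_zero, ?_, ?_⟩⟩
  · simpa using congrArg e H.trace
  · simpa [map_ofNat] using congrArg e H.sq

theorem Attached.neg {F : AbelianCubicField} {x : EisensteinInt}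
    (hF : F.Attached x) : F.Attached (-x) := by
  obtain ⟨s, t, H⟩ := hF
  exact ⟨s, -t, by simpa using H.neg⟩

theorem Attached.star {F : AbelianCubicField} {x : EisensteinInt}
    (hF : F.Attached x) : F.Attached (star x) := by
  obtain ⟨s, t, H⟩ := hF
  refine ⟨s.trans s, t, ?_⟩
  have := H.conj (s.trans s) (fun _ => rfl) (galois_pow_three F.finrank_eq s)
  simpa [sub_eq_add_neg] using this

/-- The two generators are equal or mutually inverse; in the second case x is conjugated before
`resolvent_unique` is applied. -/
theorem Attached.eq {F : AbelianCubicField} {x y : EisensteinInt} (hx : x.IsReduced)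
    (hy : y.IsReduced) (hFx : F.Attached x) (hFy : F.Attached y) :
    y = x ∨ y = -x ∨ y = Star.star x ∨ y = - Star.star x := by
  obtain ⟨s, t, H⟩ := hFx
  obtain ⟨s', t', H'⟩ := hFy
  rcases galois_eq_or F.finrank_eq H.ne_one H'.ne_one with rfl | h
  · rcases resolvent_unique F.finrank_eq hx hy H H' with h | h <;> simp [h]
  · have H2 := H.conj s' h (galois_pow_three F.finrank_eq s)
    have hxs : (Star.star x).IsReduced := by
      unfold EisensteinInt.IsReduced
      rwa [QuadraticAlgebra.norm_star]
    have := resolvent_unique F.finrank_eq hxs hy (s := s') (t := t)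
      (by simpa [sub_eq_add_neg] using H2) H'
    rcases this with h | h <;> simp [h]

end AbelianCubicField

end

/-! ### Indices of orders and discriminants of explicit families -/

section

open EisensteinInt Polynomial NumberField

/-- If `e` is a root of a cubic that is Eisenstein at `p`, then `p` does not divide the index
of `ℤ[e]`. -/
theorem dvd_coeff_of_eisenstein {A : Type*} [CommRing A] [IsDomain A] [CharZero A] {p : ℤ}
    (hp : Prime p) (hA : ∀ n : ℤ, (p : A) ∣ n → p ∣ n) {a b c : ℤ} (hc : ¬ p ∣ c) {e : A}
    (he : e ^ 3 = p * (a * e ^ 2 + b * e + c)) {W₀ W₁ W₂ : ℤ}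
    (h : (p : A) ∣ W₀ + W₁ * e + W₂ * e ^ 2) : p ∣ W₀ ∧ p ∣ W₁ ∧ p ∣ W₂ := by
  have hp0 : (p : A) ≠ 0 := by exact_mod_cast hp.ne_zero
  have he3 : (p : A) ∣ e ^ 3 := ⟨_, he⟩
  -- Cubing p ∣ W e² and cancelling p² gives p ∣ W³ u², where e³ = p u and u = c + e(ae + b).
  -- Multiplying u up to c³ + (e(ae + b))³ and using p ∣ e³ leaves p ∣ W³ c⁶ in ℤ. No prime ideals
  -- are needed.
  have key : ∀ W : ℤ, (p : A) ∣ W * e ^ 2 → p ∣ W := by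
    rintro W ⟨z, hz⟩
    have h1 : (p : A) ∣ (W : A) ^ 3 * (a * e ^ 2 + b * e + c) ^ 2 := by
      refine ⟨z ^ 3, mul_left_cancel₀ (pow_ne_zero 2 hp0) ?_⟩
      calc (p : A) ^ 2 * ((W : A) ^ 3 * (a * e ^ 2 + b * e + c) ^ 2)
          = (W : A) ^ 3 * (p * (a * e ^ 2 + b * e + c)) ^ 2 := by ring
        _ = (W * e ^ 2) ^ 3 := by rw [← he]; ring
        _ = _ := by rw [hz]; ring
    have h2 : (p : A) ∣ (W : A) ^ 3 * (c ^ 3 + (e * (a * e + b)) ^ 3) ^ 2 := by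
      have e1 : (W : A) ^ 3 * (c ^ 3 + (e * (a * e + b)) ^ 3) ^ 2 =
          ((W : A) ^ 3 * (a * e ^ 2 + b * e + c) ^ 2) *
            (c ^ 2 - c * (e * (a * e + b)) + (e * (a * e + b)) ^ 2) ^ 2 := by ring
      rw [e1]
      exact h1.mul_right _
    have h3 : (p : A) ∣ ((W ^ 3 * c ^ 6 : ℤ) : A) := by
      have e1 : ((W ^ 3 * c ^ 6 : ℤ) : A) = (W : A) ^ 3 * (c ^ 3 + (e * (a * e + b)) ^ 3) ^ 2 -
          e ^ 3 * ((W : A) ^ 3 * (a * e + b) ^ 3 * (2 * c ^ 3 + (e * (a * e + b)) ^ 3)) := by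
        push_cast; ring
      rw [e1]
      exact dvd_sub h2 (he3.mul_right _)
    rcases hp.dvd_or_dvd (hA _ h3) with h4 | h4
    · exact hp.dvd_of_dvd_pow h4
    · exact absurd (hp.dvd_of_dvd_pow h4) hc
  have hcast : ∀ W : ℤ, p ∣ W → (p : A) ∣ W := fun W hW => Int.cast_dvd_cast p W hW
  have h0 : p ∣ W₀ := by
    refine key _ ?_
    have e1 : (W₀ : A) * e ^ 2 = (W₀ + W₁ * e + W₂ * e ^ 2) * e ^ 2 - e ^ 3 * (W₁ + W₂ * e) := by
      ring
    rw [e1]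
    exact dvd_sub (h.mul_right _) (he3.mul_right _)
  have h1 : p ∣ W₁ := by
    refine key _ ?_
    have e1 : (W₁ : A) * e ^ 2 = (W₀ + W₁ * e + W₂ * e ^ 2) * e - W₀ * e - e ^ 3 * W₂ := by
      ring
    rw [e1]
    exact dvd_sub (dvd_sub (h.mul_right _) ((hcast _ h0).mul_right _)) (he3.mul_right _)
  refine ⟨h0, h1, key _ ?_⟩
  have e1 : (W₂ : A) * e ^ 2 = (W₀ + W₁ * e + W₂ * e ^ 2) - W₀ - W₁ * e := by
    ring
  rw [e1]
  exact dvd_sub (dvd_sub h (hcast _ h0)) ((hcast _ h1).mul_right _)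

section Index

variable {K : Type*} [Field K] [NumberField K]

theorem dvd_of_dvd_ringOfIntegers {p n : ℤ} (hp : p ≠ 0) (h : (p : 𝓞 K) ∣ n) : p ∣ n := by
  obtain ⟨z, hz⟩ := h
  have hz' : (n : K) = p * (z : K) := by
    have := congrArg (algebraMap (𝓞 K) K) hz
    simpa using this
  have hpK : (p : K) ≠ 0 := by exact_mod_cast hp
  have h1 : algebraMap ℚ K (n / p) = z := by
    simp only [eq_ratCast]
    push_cast
    rw [hz']
    field_simp
  have h2 : IsIntegral ℤ ((n : ℚ) / p) := by
    rw [← isIntegral_algebraMap_iff (algebraMap ℚ K).injective, h1]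
    exact z.isIntegral_coe
  obtain ⟨m, hm⟩ := IsIntegrallyClosed.isIntegral_iff.1 h2
  refine ⟨m, ?_⟩
  have hp' : (p : ℚ) ≠ 0 := by exact_mod_cast hp
  rw [eq_div_iff hp'] at hm
  have : (m : ℚ) * p = n := by simpa using hm
  have : m * p = n := by exact_mod_cast this
  linarith

/-- The discriminant of a family of integers of a cubic field, in terms of its index. -/
theorem exists_index (hK : Module.finrank ℚ K = 3) (v : Fin 3 → 𝓞 K) :
    ∃ m : ℤ, Algebra.discr ℤ v = m ^ 2 * discr K ∧ ∀ p : ℤ, Prime p → p ∣ m →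
      ∃ W : Fin 3 → ℤ, (∃ i, ¬ p ∣ W i) ∧ (p : 𝓞 K) ∣ W 0 * v 0 + W 1 * v 1 + W 2 * v 2 := by
  have hcard : Fintype.card (Module.Free.ChooseBasisIndex ℤ (𝓞 K)) = 3 := by
    rw [← Module.finrank_eq_card_chooseBasisIndex, RingOfIntegers.rank, hK]
  let B : Module.Basis (Fin 3) ℤ (𝓞 K) :=
    (RingOfIntegers.basis K).reindex (Fintype.equivFinOfCardEq hcard)
  let P : Matrix (Fin 3) (Fin 3) ℤ := Matrix.of fun i j => B.repr (v i) j
  have hv : ∀ i, v i = ∑ j, (P i j : 𝓞 K) * B j := by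
    intro i
    conv_lhs => rw [← B.sum_repr (v i)]
    simp [P]
  have hvB : v = (P.map (algebraMap ℤ (𝓞 K))).mulVec B := by
    ext1 i
    rw [hv i]
    simp [Matrix.mulVec, dotProduct]
  refine ⟨P.det, ?_, ?_⟩
  · conv_lhs => rw [hvB, Algebra.discr_of_matrix_mulVec, discr_eq_discr]
  · intro p hp hpd
    obtain ⟨q, hq⟩ : ∃ q : ℕ, q = p.natAbs := ⟨_, rfl⟩
    have hqp : q.Prime := by rw [hq]; exact Int.prime_iff_natAbs_prime.1 hp
    have := Fact.mk hqp
    have hdvd : ∀ n : ℤ, p ∣ n ↔ (n : ZMod q) = 0 := by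
      intro n
      rw [ZMod.intCast_zmod_eq_zero_iff_dvd, hq, Int.natCast_natAbs, abs_dvd]
    have hdet : (P.map (Int.castRingHom (ZMod q))).det = 0 := by
      have hmap := RingHom.map_det (Int.castRingHom (ZMod q)) P
      rw [RingHom.mapMatrix_apply] at hmap
      rw [← hmap]
      exact (hdvd _).1 hpd
    -- A singular matrix mod p has a nonzero row relation, and it lifts to a combination of the `v
    -- i` divisible by p with not all coefficients divisible by p.
    obtain ⟨w, hw0, hw⟩ := Matrix.exists_vecMul_eq_zero_iff.2 hdet
    choose W hW using fun i => ZMod.intCast_surjective (w i)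
    refine ⟨W, ?_, ?_⟩
    · by_contra! hc
      exact hw0 (funext fun i => by rw [← hW]; exact (hdvd _).1 (hc i))
    · have hj : ∀ j, p ∣ W 0 * P 0 j + W 1 * P 1 j + W 2 * P 2 j := by
        intro j
        rw [hdvd]
        push_cast
        have := congrFun hw j
        rw [Matrix.vecMul, dotProduct, Fin.sum_univ_three] at this
        simpa [← hW] using this
      choose u hu using hj
      refine ⟨∑ j, (u j : 𝓞 K) * B j, ?_⟩
      rw [hv 0, hv 1, hv 2, Finset.mul_sum, Finset.mul_sum, Finset.mul_sum, Finset.mul_sum,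
        ← Finset.sum_add_distrib, ← Finset.sum_add_distrib]
      refine Finset.sum_congr rfl fun j _ => ?_
      have := congrArg (Int.cast : ℤ → 𝓞 K) (hu j)
      push_cast at this
      linear_combination B j * this

end Index

namespace IsResolvent

variable {K : Type*} [Field K] [NumberField K] {s : K ≃ₐ[ℚ] K} {t : K} {x : EisensteinInt}

theorem trace_ratCast (hK : Module.finrank ℚ K = 3) (q : ℚ) :
    Algebra.trace ℚ K (q : K) = 3 * q := by
  have := Algebra.trace_algebraMap (S := K) q
  rw [hK] at this
  simpa using this

theorem trace_eq_zero {g h : ℚ} (H : IsResolvent s t g h) :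
    Algebra.trace ℚ K t = 0 ∧ Algebra.trace ℚ K (s t) = 0 := by
  have h1 : ∀ z, Algebra.trace ℚ K (s z) = Algebra.trace ℚ K z := fun z =>
    Algebra.trace_eq_of_algEquiv s z
  have h2 := congrArg (Algebra.trace ℚ K) H.trace
  rw [map_add, map_add, h1 (s t), h1 t, map_zero] at h2
  rw [h1]
  constructor <;> linarith

theorem trace_combination (hK : Module.finrank ℚ K = 3) {g h : ℚ} (H : IsResolvent s t g h)
    (a b c : ℚ) : Algebra.trace ℚ K (a + b * t + c * s t) = 3 * a := by
  have e1 : (a : K) + b * t + c * s t = a + b • t + c • s t := by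
    simp [Algebra.smul_def]
  rw [e1, map_add, map_add, map_smul, map_smul, H.trace_eq_zero.1, H.trace_eq_zero.2,
    trace_ratCast hK]
  simp

/-- The free a and b serve two families: a = 0, b = 1 for 1, t, s(t), and b = 1/3 for the finer
family available when 3 ∣ h. -/
theorem discr_eq (hK : Module.finrank ℚ K = 3) {g h : ℚ} (H : IsResolvent s t g h) (a b : ℚ) :
    Algebra.discr ℚ ![1, b * (a + t), b * (a + s t)] =
      81 * b ^ 4 * (g ^ 2 - g * h + h ^ 2) ^ 2 := by
  obtain ⟨n, hn⟩ : ∃ n, n = g ^ 2 - g * h + h ^ 2 := ⟨_, rfl⟩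
  have hnK : (n : K) = g ^ 2 - g * h + h ^ 2 := by rw [hn]; push_cast; ring
  have h11 : Algebra.trace ℚ K (1 * 1) = 3 := by
    have := trace_ratCast (K := K) hK 1
    simpa using this
  have h1t : Algebra.trace ℚ K (1 * (b * (a + t))) = 3 * (b * a) := by
    rw [← H.trace_combination hK (b * a) b 0]
    congr 1; push_cast; ring
  have h1s : Algebra.trace ℚ K (1 * (b * (a + s t))) = 3 * (b * a) := by
    rw [← H.trace_combination hK (b * a) 0 b]
    congr 1; push_cast; ring
  have htt : Algebra.trace ℚ K (b * (a + t) * (b * (a + t))) = 3 * (b ^ 2 * (a ^ 2 + 2 * n)) := by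
    rw [← H.trace_combination hK (b ^ 2 * (a ^ 2 + 2 * n)) (b ^ 2 * (2 * a + g)) (b ^ 2 * h)]
    congr 1; push_cast; rw [hnK]
    linear_combination (b : K) ^ 2 * H.sq
  have hss : Algebra.trace ℚ K (b * (a + s t) * (b * (a + s t))) =
      3 * (b ^ 2 * (a ^ 2 + 2 * n)) := by
    rw [← H.trace_combination hK (b ^ 2 * (a ^ 2 + 2 * n)) (- b ^ 2 * h) (b ^ 2 * (2 * a + g - h))]
    congr 1; push_cast; rw [hnK]
    linear_combination (b : K) ^ 2 * H.sq_apply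
  have hts : Algebra.trace ℚ K (b * (a + t) * (b * (a + s t))) = 3 * (b ^ 2 * (a ^ 2 - n)) := by
    rw [← H.trace_combination hK (b ^ 2 * (a ^ 2 - n)) (b ^ 2 * (a - g + h)) (b ^ 2 * (a - g))]
    congr 1; push_cast; rw [hnK]
    linear_combination (b : K) ^ 2 * H.mul_apply
  rw [Algebra.discr_def, Matrix.det_fin_three]
  simp only [Algebra.traceMatrix_apply, Algebra.traceForm_apply, Matrix.cons_val_zero,
    Matrix.cons_val_one, Matrix.cons_val]
  rw [mul_comm (b * (a + t) : K) 1, mul_comm (b * (a + s t) : K) 1,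
    mul_comm (b * (a + s t) : K) (b * (a + t)), h11, h1t, h1s, htt, hss, hts, ← hn]
  ring

end IsResolvent

end

/-! ### The discriminant of the field attached to a reduced element -/

section

open EisensteinInt Polynomial NumberField

theorem coe_discr_ringOfIntegers {K : Type*} [Field K] [NumberField K] {ι : Type*} [Fintype ι]
    [DecidableEq ι] (v : ι → 𝓞 K) :
    ((Algebra.discr ℤ v : ℤ) : ℚ) = Algebra.discr ℚ (fun i => (v i : K)) := by
  rw [Algebra.discr_def, Algebra.discr_def]
  have h := RingHom.map_det (Int.castRingHom ℚ) (Algebra.traceMatrix ℤ v)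
  rw [RingHom.mapMatrix_apply] at h
  rw [← eq_intCast (Int.castRingHom ℚ), h]
  congr 1
  ext i j
  simp [Algebra.traceMatrix_apply, Algebra.traceForm_apply, Algebra.coe_trace_int]

theorem isIntegral_of_cubic {A : Type*} [CommRing A] {z : A} (a b c : ℤ)
    (h : z ^ 3 + a * z ^ 2 + b * z + c = 0) : IsIntegral ℤ z := by
  refine ⟨Cubic.toPoly ⟨1, a, b, c⟩, Cubic.monic_of_a_eq_one rfl, ?_⟩
  simp only [Cubic.toPoly, eval₂_add, eval₂_mul, eval₂_C, eval₂_pow, eval₂_X,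
    eq_intCast (algebraMap ℤ A)]
  push_cast
  linear_combination h

/-- An index m satisfying d m² = r² divides r, so only primes dividing r have to be excluded from m.
-/
theorem eq_of_sq_mul_eq {d m r : ℤ} (h : d * m ^ 2 = r ^ 2)
    (hm : ∀ p : ℕ, p.Prime → (p : ℤ) ∣ r → ¬ (p : ℤ) ∣ m) : d = r ^ 2 := by
  have h1 : m ∣ r := by
    rw [← Int.pow_dvd_pow_iff two_ne_zero, ← h]
    exact dvd_mul_left _ _
  have h2 : m.natAbs = 1 := by
    by_contra hc
    obtain ⟨p, hp, hpd⟩ := Nat.exists_prime_and_dvd hc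
    have hpd := Int.natCast_dvd.2 hpd
    exact hm p hp (hpd.trans h1) hpd
  have h3 : m ^ 2 = 1 := by
    rw [← Int.natAbs_sq, h2]; norm_num
  rw [← h, h3, mul_one]

namespace IsResolvent

variable {K : Type*} [Field K] [NumberField K] {s : K ≃ₐ[ℚ] K} {t : K} {x : EisensteinInt}

theorem pow_three_int (H : IsResolvent s t x.re x.im) :
    t ^ 3 = 3 * (nrm x : K) * t + (nrm x : K) * (2 * x.re - x.im) := by
  have := H.pow_three
  rw [norm_eq]
  push_cast at this ⊢
  exact this

theorem isIntegral (H : IsResolvent s t x.re x.im) : IsIntegral ℤ t := by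
  refine isIntegral_of_cubic 0 (-(3 * nrm x)) (-(nrm x * (2 * x.re - x.im))) ?_
  push_cast
  linear_combination H.pow_three_int

/-- The sign a = ±1 is chosen with a ≡ g mod 3; then n ≡ 1 mod 3 and the cubic of (a + t)/3 has
integer coefficients. -/
theorem isIntegral_div_three (H : IsResolvent s t x.re x.im) (hx : x.IsReduced)
    (h3 : 3 ∣ x.im) : ∃ a : ℤ, IsIntegral ℤ ((a + t) / 3) := by
  obtain ⟨h, hh⟩ := h3
  have hg : ¬ 3 ∣ x.re := by
    rintro ⟨g, hg⟩
    apply hx.2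
    rw [norm_eq, hg, hh]
    exact ⟨3 * g ^ 2 - 3 * g * h + 3 * h ^ 2, by ring⟩
  obtain ⟨a, k, hk, ha⟩ : ∃ a k : ℤ, a * x.re = 1 + 3 * k ∧ a ^ 2 = 1 := by
    rcases (by omega : x.re % 3 = 1 ∨ x.re % 3 = 2) with h | h
    · exact ⟨1, x.re / 3, by omega, by norm_num⟩
    · exact ⟨-1, (-x.re) / 3, by omega, by norm_num⟩
  refine ⟨a, ?_⟩
  have hre : x.re = a * (1 + 3 * k) := by rw [← hk, ← mul_assoc, ← pow_two, ha, one_mul]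
  obtain ⟨l, hl⟩ : ∃ l, l = a * h := ⟨_, rfl⟩
  have him : x.im = 3 * a * l := by rw [hh, hl]; linear_combination (-3 * h) * ha
  have hn : nrm x = 1 + 3 * (2 * k + 3 * k ^ 2 - l - 3 * k * l + 3 * l ^ 2) := by
    rw [norm_eq, hre, him]
    linear_combination ((1 + 3 * k) ^ 2 - (1 + 3 * k) * (3 * l) + (3 * l) ^ 2) * ha
  refine isIntegral_of_cubic (-a) (-(2 * k + 3 * k ^ 2 - l - 3 * k * l + 3 * l ^ 2))
    (-(a * (k ^ 2 - k * l + (2 * k - l) * (k ^ 2 - k * l + l ^ 2)))) ?_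
  have := H.pow_three_int
  rw [hn, hre, him] at this
  have ha' : (a : K) ^ 2 = 1 := by exact_mod_cast ha
  push_cast at this ⊢
  linear_combination this / 27 + (-2 * (a : K) / 27 - t / 9) * ha'

theorem not_dvd_im (hx : x.IsReduced) {p : ℕ} (hp : p.Prime) (hpx : (p : ℤ) ∣ nrm x) :
    ¬ (p : ℤ) ∣ x.im := by
  have hpp := Nat.prime_iff_prime_int.1 hp
  intro h
  have h7 : (p : ℤ) ∣ x.re := by
    refine hpp.dvd_of_dvd_pow (n := 2) ?_
    have : x.re ^ 2 = nrm x - (x.im - x.re) * x.im := by rw [norm_eq]; ring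
    rw [this]
    exact dvd_sub hpx (h.mul_left _)
  obtain ⟨a, ha⟩ := h
  obtain ⟨b, hb⟩ := h7
  have : (p : ℤ) * p ∣ nrm x := ⟨b ^ 2 - b * a + a ^ 2, by rw [norm_eq, ha, hb]; ring⟩
  exact hpp.not_isUnit (hx.1 _ this)

/-- Multiplying by h turns a relation in 1, t, s(t) into one in powers of t, since h s(t) = t² − 2n
− g t; as p ∤ h nothing is lost at p. The shift d allows for cubics that are Eisenstein only after
translation. -/
theorem not_dvd_index (H : IsResolvent s t x.re x.im) {p : ℤ} (hp : Prime p)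
    (him : ¬ p ∣ x.im) {a b c d : ℤ} (hc : ¬ p ∣ c)
    (hE : (t - d) ^ 3 = p * (a * (t - d) ^ 2 + b * (t - d) + c))
    {T S : 𝓞 K} (hT : algebraMap (𝓞 K) K T = t) (hS : algebraMap (𝓞 K) K S = s t)
    {W : Fin 3 → ℤ}
    (hW : (p : 𝓞 K) ∣ W 0 * 1 + W 1 * T + W 2 * S) : ∀ i, p ∣ W i := by
  have hE' : (T - d) ^ 3 = p * (a * (T - d) ^ 2 + b * (T - d) + (c : 𝓞 K)) := by
    apply FaithfulSMul.algebraMap_injective (𝓞 K) K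
    simp only [map_sub, map_mul, map_pow, map_add, map_intCast, hT]
    exact hE
  have hsq : T ^ 2 = 2 * (nrm x : 𝓞 K) + x.re * T + x.im * S := by
    apply FaithfulSMul.algebraMap_injective (𝓞 K) K
    have := H.sq
    rw [norm_eq]
    simp only [map_mul, map_pow, map_add, map_intCast, map_ofNat, hT, hS]
    push_cast at this ⊢
    exact this
  have key := dvd_coeff_of_eisenstein hp (fun n => dvd_of_dvd_ringOfIntegers hp.ne_zero) hc hE'
    (W₀ := x.im * W 0 - 2 * nrm x * W 2 + (x.im * W 1 - x.re * W 2) * d + W 2 * d ^ 2)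
    (W₁ := x.im * W 1 - x.re * W 2 + 2 * W 2 * d) (W₂ := W 2) (by
      have e1 := hW.mul_left (x.im : 𝓞 K)
      convert e1 using 1
      push_cast
      linear_combination (W 2 : 𝓞 K) * hsq)
  obtain ⟨k0, k1, k2⟩ := key
  have h1 : p ∣ x.im * W 1 := by
    have e : x.im * W 1 = (x.im * W 1 - x.re * W 2 + 2 * W 2 * d) - W 2 * (2 * d - x.re) := by ring
    rw [e]
    exact dvd_sub k1 (k2.mul_right _)
  have h0 : p ∣ x.im * W 0 := by
    have e : x.im * W 0 = (x.im * W 0 - 2 * nrm x * W 2 + (x.im * W 1 - x.re * W 2) * d +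
      W 2 * d ^ 2) - W 2 * (d ^ 2 - x.re * d - 2 * nrm x) - x.im * W 1 * d := by ring
    rw [e]
    exact dvd_sub (dvd_sub k0 (k2.mul_right _)) (h1.mul_right _)
  intro i
  fin_cases i
  · exact (hp.dvd_or_dvd h0).resolve_left him
  · exact (hp.dvd_or_dvd h1).resolve_left him
  · exact k2

/-- The family 1, t, s(t) has discriminant 81n². At primes p ∣ n the cubic of t is Eisenstein, so p
does not divide the index m. Only the prime 3 remains, and there the two cases differ. -/
theorem discr_eq_of_isReduced (hK : Module.finrank ℚ K = 3) (H : IsResolvent s t x.re x.im)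
    (hx : x.IsReduced) :
    discr K = (if 3 ∣ x.im then nrm x else 9 * nrm x) ^ 2 := by
  let T : 𝓞 K := ⟨t, H.isIntegral⟩
  let S : 𝓞 K := ⟨s t, H.isIntegral.map s⟩
  obtain ⟨m, hm, hmp⟩ := exists_index hK ![1, T, S]
  have hd : Algebra.discr ℤ ![1, T, S] = 81 * nrm x ^ 2 := by
    have h1 := H.discr_eq hK 0 1
    have h2 := coe_discr_ringOfIntegers ![1, T, S]
    have h3 : (fun i => ((![1, T, S] i : 𝓞 K) : K)) =
        ![1, ((1 : ℚ) : K) * (((0 : ℚ) : K) + t), ((1 : ℚ) : K) * (((0 : ℚ) : K) + s t)] := by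
      ext i
      fin_cases i
      · simp
      · simp [T]; rfl
      · simp [S]; rfl
    rw [h3, h1] at h2
    rw [norm_eq]
    have h4 : ((Algebra.discr ℤ ![1, T, S] : ℤ) : ℚ) =
        ((81 * (x.re ^ 2 - x.re * x.im + x.im ^ 2) ^ 2 : ℤ) : ℚ) := by
      rw [h2]; push_cast; ring
    exact_mod_cast h4
  rw [hd] at hm
  have main : ∀ p : ℤ, Prime p → ¬ p ∣ x.im → ∀ a b c d : ℤ, ¬ p ∣ c →
      (t - d) ^ 3 = p * (a * (t - d) ^ 2 + b * (t - d) + c) → ¬ p ∣ m := by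
    intro p hp him a b c d hc hE hpm
    obtain ⟨W, ⟨i, hi⟩, hW⟩ := hmp p hp hpm
    exact hi (H.not_dvd_index hp him hc hE (T := T) (S := S) rfl rfl hW i)
  have hm1 : ∀ p : ℕ, p.Prime → (p : ℤ) ∣ nrm x → ¬ (p : ℤ) ∣ m := by
    intro p hp hpx
    have hpp := Nat.prime_iff_prime_int.1 hp
    have hpx' := hpx
    obtain ⟨f, hf⟩ := hpx'
    refine main p hpp (not_dvd_im hx hp hpx) 0 (3 * f) (f * (2 * x.re - x.im)) 0 ?_ ?_
    · intro h
      rcases hpp.dvd_or_dvd h with ⟨k, rfl⟩ | h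
      · exact hpp.not_isUnit (hx.1 p ⟨k, by rw [hf]; ring⟩)
      · exact hx.not_dvd_trace hp hpx h
    · have := H.pow_three_int
      rw [hf] at this
      push_cast at this ⊢
      linear_combination this
  split_ifs with h3
  · obtain ⟨a, ha⟩ := H.isIntegral_div_three hx h3
    let T' : 𝓞 K := ⟨(a + t) / 3, ha⟩
    let S' : 𝓞 K := ⟨s ((a + t) / 3), ha.map s⟩
    obtain ⟨m', hm', -⟩ := exists_index hK ![1, T', S']
    have hd' : Algebra.discr ℤ ![1, T', S'] = nrm x ^ 2 := by
      have h1 := H.discr_eq hK a (1 / 3)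
      have h2 := coe_discr_ringOfIntegers ![1, T', S']
      have h3 : (fun i => ((![1, T', S'] i : 𝓞 K) : K)) =
          ![1, ((1 / 3 : ℚ) : K) * (((a : ℚ) : K) + t), ((1 / 3 : ℚ) : K) * (((a : ℚ) : K) + s t)] := by
        ext i
        fin_cases i
        · simp
        · change (a + t) / 3 = _
          simp; ring
        · change s ((a + t) / 3) = _
          simp [map_ofNat]; ring
      rw [h3, h1] at h2
      rw [norm_eq]
      have h4 : ((Algebra.discr ℤ ![1, T', S'] : ℤ) : ℚ) =
          (((x.re ^ 2 - x.re * x.im + x.im ^ 2) ^ 2 : ℤ) : ℚ) := by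
        rw [h2]; push_cast; ring
      exact_mod_cast h4
    rw [hd'] at hm'
    -- The finer family has index m' with m = ±9m', so a prime dividing n does not divide m' either.
    have hmm : (9 * m') ^ 2 = m ^ 2 := by
      refine mul_right_cancel₀ (discr_ne_zero K) ?_
      linear_combination hm - 81 * hm'
    refine eq_of_sq_mul_eq (m := m') (by linarith) fun p hp hpx hpm => hm1 p hp hpx ?_
    rw [sq_eq_sq_iff_eq_or_eq_neg] at hmm
    rcases hmm with h | h
    · rw [← h]; exact hpm.mul_left _
    · rw [← neg_eq_iff_eq_neg.2 h, dvd_neg]; exact hpm.mul_left _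
  · refine eq_of_sq_mul_eq (m := m) (by linarith) fun p hp hpx => ?_
    have hpp := Nat.prime_iff_prime_int.1 hp
    rcases hpp.dvd_or_dvd hpx with h | h
    · have hp3 : p = 3 := by
        have : (p : ℤ) ∣ 3 ^ 2 := by norm_num; exact h
        have := hpp.dvd_of_dvd_pow this
        exact (Nat.prime_dvd_prime_iff_eq hp Nat.prime_three).1 (by exact_mod_cast this)
      subst hp3
      have h4 := four_mul_norm x
      have ha : ¬ (3 : ℤ) ∣ 2 * x.re - x.im := by
        rintro ⟨k, hk⟩
        rw [hk] at h4
        exact hx.2 (by ring_nf at h4; omega)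
      -- At 3 the cubic is Eisenstein after the shift by τ = 2g − h: its value at τ is τ³ − 4nτ =
      -- −3τh², and 3 divides neither τ nor h.
      refine main _ hpp h3 (-(2 * x.re - x.im)) (nrm x - (2 * x.re - x.im) ^ 2)
        ((2 * x.re - x.im) * x.im ^ 2) (2 * x.re - x.im) ?_ ?_
      · intro hc
        rcases hpp.dvd_or_dvd hc with hc | hc
        · exact ha hc
        · exact h3 (hpp.dvd_of_dvd_pow hc)
      · have := H.pow_three_int
        have h4' := congrArg (Int.cast : ℤ → K) h4
        push_cast at this h4' ⊢
        linear_combination this + (2 * x.re - x.im : K) * h4'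
    · exact hm1 p hp h

end IsResolvent

theorem AbelianCubicField.Attached.discr_eq {F : AbelianCubicField} {x : EisensteinInt}
    (hF : F.Attached x) (hx : x.IsReduced) :
    discr F.carrier = (if 3 ∣ x.im then nrm x else 9 * nrm x) ^ 2 := by
  obtain ⟨s, t, H⟩ := hF
  exact H.discr_eq_of_isReduced F.finrank_eq hx

end

/-! ### From counting fields to counting reduced elements -/

section

open EisensteinInt NumberField
open scoped QuadraticAlgebra

namespace EisensteinInt

/-- The conductor of the abelian cubic field attached to a reduced Eisenstein integer. -/
def conductor (x : EisensteinInt) : ℤ := if 3 ∣ x.im then nrm x else 9 * nrm x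

theorem nrm_le_conductor (x : EisensteinInt) : nrm x ≤ conductor x := by
  have := norm_nonneg x
  unfold conductor
  split_ifs <;> linarith

theorem conductor_nonneg (x : EisensteinInt) : 0 ≤ conductor x :=
  (norm_nonneg x).trans (nrm_le_conductor x)

/-- The reduced Eisenstein integers whose conductor has square less than `X`. -/
def reducedLT (X : ℝ) : Set EisensteinInt :=
  {x | x.IsReduced ∧ ((conductor x ^ 2 : ℤ) : ℝ) < X}

theorem finite_reducedLT (X : ℝ) : (reducedLT X).Finite := by
  refine (finite_nrm_le ⌈X⌉).subset fun x hx => ?_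
  have h1 := nrm_le_conductor x
  have h2 : conductor x ≤ conductor x ^ 2 := by
    rcases (conductor_nonneg x).eq_or_lt with h | h
    · rw [← h]; simp
    · nlinarith
  have h3 : ((nrm x : ℤ) : ℝ) ≤ ⌈X⌉ := by
    have : ((nrm x : ℤ) : ℝ) ≤ ((conductor x ^ 2 : ℤ) : ℝ) := by exact_mod_cast h1.trans h2
    exact this.trans (hx.2.le.trans (Int.le_ceil X))
  exact_mod_cast h3

theorem ncard_orbit {x : EisensteinInt} (hx : x.IsReduced) (him : x.im ≠ 0) :
    ({x, -x, star x, -star x} : Set EisensteinInt).ncard = 4 := by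
  have h1 : x ≠ -x := fun h => by
    have := congrArg QuadraticAlgebra.im h
    simp at this
    omega
  have h2 : x ≠ star x := fun h => by
    have := congrArg QuadraticAlgebra.im h
    simp at this
    omega
  -- Equality would give h = 2g and norm 3g².
  have h3 : x ≠ - star x := fun h => by
    have := congrArg QuadraticAlgebra.re h
    simp at this
    apply hx.2
    rw [norm_eq, show x.im = 2 * x.re by omega]
    exact ⟨x.re ^ 2, by ring⟩
  have h4 : star x ≠ - star x := fun h => by
    have := congrArg QuadraticAlgebra.im h
    simp at this
    omega
  rw [Set.ncard_insert_of_notMem, Set.ncard_insert_of_notMem, Set.ncard_pair h4]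
  · simp only [Set.mem_insert_iff, Set.mem_singleton_iff, not_or]
    exact ⟨fun h => h3 (neg_eq_iff_eq_neg.1 h), fun h => h2 (neg_injective h)⟩
  · simp only [Set.mem_insert_iff, Set.mem_singleton_iff, not_or]
    exact ⟨h1, h2, h3⟩

theorem isReduced_orbit {x y : EisensteinInt} (hx : x.IsReduced)
    (h : y = x ∨ y = -x ∨ y = star x ∨ y = - star x) : nrm y = nrm x ∧ y.IsReduced ∧
      (3 ∣ y.im ↔ 3 ∣ x.im) ∧ (y.im = 0 ↔ x.im = 0) := by
  unfold IsReduced at hx ⊢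
  rcases h with rfl | rfl | rfl | rfl <;>
    simp [QuadraticAlgebra.norm_neg, QuadraticAlgebra.norm_star, hx]

/-- The number of primary reduced Eisenstein integers of a given norm. -/
noncomputable def reducedCount (n : ℕ) : ℕ :=
  open Classical in if Squarefree n ∧ ¬ 3 ∣ n then primaryCount n else 0

theorem ncard_reduced_lt (p : EisensteinInt → Prop) (k N : ℕ)
    (hp : ∀ n : ℕ, ¬ 3 ∣ n → {x : EisensteinInt | nrm x = n ∧ p x}.ncard = k * primaryCount n) :
    {x : EisensteinInt | x.IsReduced ∧ p x ∧ nrm x < N}.ncard =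
      k * ∑ n ∈ Finset.range N, reducedCount n := by
  induction N with
  | zero =>
    have : {x : EisensteinInt | x.IsReduced ∧ p x ∧ nrm x < (0 : ℕ)} = ∅ := by
      rw [Set.eq_empty_iff_forall_notMem]
      rintro x ⟨-, -, h⟩
      have := norm_nonneg x
      simp at h
      omega
    rw [this]
    simp
  | succ N ih =>
    rw [Finset.sum_range_succ, mul_add, ← ih]
    have h1 : {x : EisensteinInt | x.IsReduced ∧ p x ∧ nrm x < ((N + 1 : ℕ) : ℤ)} =
        {x : EisensteinInt | x.IsReduced ∧ p x ∧ nrm x < N} ∪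
          {x : EisensteinInt | x.IsReduced ∧ p x ∧ nrm x = N} := by
      ext x
      simp only [Set.mem_ofPred_eq, Set.mem_union, ← and_or_left]
      push_cast
      rw [Int.lt_add_one_iff, le_iff_lt_or_eq]
    have h2 : {x : EisensteinInt | x.IsReduced ∧ p x ∧ nrm x = N}.ncard = k * reducedCount N := by
      unfold reducedCount
      split_ifs with hN
      · rw [← hp N hN.2]
        congr 1
        ext x
        simp only [Set.mem_ofPred_eq]
        constructor
        · rintro ⟨-, h, h'⟩
          exact ⟨h', h⟩
        · rintro ⟨h', h⟩
          refine ⟨?_, h, h'⟩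
          unfold IsReduced
          rw [h', Int.squarefree_natCast]
          exact_mod_cast hN
      · rw [mul_zero, Set.ncard_eq_zero ((finite_nrm_eq N).subset fun x hx => hx.2.2),
          Set.eq_empty_iff_forall_notMem]
        rintro x ⟨h, -, h'⟩
        unfold IsReduced at h
        rw [h', Int.squarefree_natCast] at h
        exact hN (by exact_mod_cast h)
    rw [h1, Set.ncard_union_eq _ ((finite_nrm_le N).subset fun x hx => hx.2.2.le)
      ((finite_nrm_eq N).subset fun x hx => hx.2.2), h2]
    rw [Set.disjoint_left]
    rintro x ⟨-, -, h⟩ ⟨-, -, h'⟩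
    omega

theorem ncard_reducedLT (X : ℝ) :
    (reducedLT X).ncard = 2 * ∑ n ∈ Finset.range ⌈√X⌉₊, reducedCount n +
      4 * ∑ n ∈ Finset.range ⌈√X / 9⌉₊, reducedCount n := by
  have hlt : ∀ (n : ℤ) (Y : ℝ), 0 ≤ n → (n < (⌈Y⌉₊ : ℤ) ↔ (n : ℝ) < Y) := by
    intro n Y hn
    lift n to ℕ using hn
    rw [Nat.cast_lt, Nat.lt_ceil, Int.cast_natCast]
  have hA := ncard_reduced_lt (fun x => 3 ∣ x.im) 2 ⌈√X⌉₊ fun n hn => ncard_three_dvd_im hn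
  have hC := ncard_reduced_lt (fun x => ¬ 3 ∣ x.im) 4 ⌈√X / 9⌉₊ fun n hn =>
    ncard_not_three_dvd_im hn
  have hd : Disjoint {x : EisensteinInt | x.IsReduced ∧ 3 ∣ x.im ∧ nrm x < ⌈√X⌉₊}
      {x : EisensteinInt | x.IsReduced ∧ ¬ 3 ∣ x.im ∧ nrm x < ⌈√X / 9⌉₊} := by
    rw [Set.disjoint_left]
    rintro x ⟨-, h, -⟩ ⟨-, h', -⟩
    exact h' h
  rw [← hA, ← hC, ← Set.ncard_union_eq hd ((finite_nrm_le _).subset fun x hx => hx.2.2.le)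
    ((finite_nrm_le _).subset fun x hx => hx.2.2.le)]
  congr 1
  ext x
  have h0 := norm_nonneg x
  have hc : ((conductor x ^ 2 : ℤ) : ℝ) < X ↔ (conductor x : ℝ) < √X := by
    rw [Real.lt_sqrt (by exact_mod_cast conductor_nonneg x)]
    push_cast
    rfl
  simp only [reducedLT, Set.mem_ofPred_eq, Set.mem_union, ← and_or_left, hc]
  refine and_congr_right fun _ => ?_
  rw [hlt _ _ h0, hlt _ _ h0, lt_div_iff₀ (by norm_num)]
  unfold conductor
  by_cases h3 : 3 ∣ x.im
  · simp [h3]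
  · simp [h3, mul_comm]

theorem ncard_reducedLT_im_eq_zero {X : ℝ} (hX : 1 < X) :
    {x | x ∈ reducedLT X ∧ x.im = 0}.ncard = 2 := by
  have h : {x | x ∈ reducedLT X ∧ x.im = 0} = {1, -1} := by
    ext x
    simp only [Set.mem_ofPred_eq, Set.mem_insert_iff, Set.mem_singleton_iff]
    constructor
    · rintro ⟨⟨hx, -⟩, h0⟩
      have h1 : nrm x = x.re * x.re := by rw [norm_eq, h0]; ring
      have h2 := Int.isUnit_iff.1 (hx.1 x.re (h1 ▸ dvd_rfl))
      rcases h2 with h | h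
      · left; ext <;> simp [h, h0]
      · right; ext <;> simp [h, h0]
    · have h1 : (1 : EisensteinInt) ∈ reducedLT X := by
        refine ⟨⟨by simp, by simp⟩, ?_⟩
        simpa [conductor] using hX
      have h2 : (-1 : EisensteinInt) ∈ reducedLT X := by
        refine ⟨⟨by simp [QuadraticAlgebra.norm_neg], by simp [QuadraticAlgebra.norm_neg]⟩, ?_⟩
        simpa [conductor, QuadraticAlgebra.norm_neg] using hX
      rintro (rfl | rfl)
      · exact ⟨h1, by simp⟩
      · exact ⟨h2, by simp⟩
  rw [h, Set.ncard_pair]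
  intro h
  have := congrArg QuadraticAlgebra.re h
  simp at this

end EisensteinInt

namespace AbelianCubicField

theorem discr_attached {F : AbelianCubicField} {x : EisensteinInt}
    (hF : F.Attached x) (hx : x.IsReduced) :
    IsoClass.discr (Quotient.mk isoSetoid F) = EisensteinInt.conductor x ^ 2 := hF.discr_eq hx

theorem exists_classOf : ∃ Φ : EisensteinInt → IsoClass,
    ∀ x : EisensteinInt, x.IsReduced → x.im ≠ 0 →
      ∃ F : AbelianCubicField, F.Attached x ∧ Φ x = Quotient.mk isoSetoid F := by
  classical
  have h : ∀ x : EisensteinInt, ∃ c : IsoClass, x.IsReduced → x.im ≠ 0 →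
      ∃ F : AbelianCubicField, F.Attached x ∧ c = Quotient.mk isoSetoid F := by
    intro x
    by_cases hx : x.IsReduced ∧ x.im ≠ 0
    · obtain ⟨F, hF⟩ := exists_field_attached hx.1 hx.2
      exact ⟨Quotient.mk isoSetoid F, fun _ _ => ⟨F, hF, rfl⟩⟩
    -- Default value outside the relevant elements: the field of ω, which is reduced of norm 1.
    · obtain ⟨F, hF⟩ := exists_field_attached (x := QuadraticAlgebra.omega)
        ⟨by rw [nrm_omega]; exact squarefree_one, by rw [nrm_omega]; norm_num⟩ (by simp)
      exact ⟨Quotient.mk isoSetoid F, fun h1 h2 => absurd ⟨h1, h2⟩ hx⟩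
  choose Φ hΦ using h
  exact ⟨Φ, hΦ⟩

/-- Sending a reduced element to its field maps a finite set onto the classes to be counted, and
each fibre is an orbit {±x, ±x̄} of size 4. -/
theorem finite_and_card_discrLT (X : ℝ) : (discrLT X).Finite ∧
    4 * (discrLT X).ncard = {x | x ∈ reducedLT X ∧ x.im ≠ 0}.ncard := by
  classical
  obtain ⟨Φ, hΦ⟩ := exists_classOf
  set S := {x | x ∈ reducedLT X ∧ x.im ≠ 0} with hS
  have hSf : S.Finite := (finite_reducedLT X).subset fun x hx => hx.1
  have himg : discrLT X = Φ '' S := by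
    ext c
    constructor
    · intro hc
      induction c using Quotient.inductionOn with
      | h F =>
        obtain ⟨x, hx, him, hF⟩ := F.exists_attached
        obtain ⟨G, hG, hGc⟩ := hΦ x hx him
        have hc' : ((IsoClass.discr (Quotient.mk isoSetoid F) : ℤ) : ℝ) < X := hc
        rw [discr_attached hF hx] at hc'
        exact ⟨x, ⟨⟨hx, hc'⟩, him⟩, by rw [hGc]; exact Quotient.sound (hG.equiv hx hF)⟩
    · rintro ⟨x, ⟨⟨hx, hxX⟩, him⟩, rfl⟩
      obtain ⟨G, hG, hGc⟩ := hΦ x hx him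
      change ((IsoClass.discr (Φ x) : ℤ) : ℝ) < X
      rw [hGc, discr_attached hG hx]
      exact hxX
  refine ⟨himg ▸ hSf.image _, ?_⟩
  have hfib : ∀ c ∈ hSf.toFinset.image Φ, (hSf.toFinset.filter fun x => Φ x = c).card = 4 := by
    intro c hc
    obtain ⟨x, hxS, rfl⟩ := Finset.mem_image.1 hc
    obtain ⟨⟨hx, hxX⟩, him⟩ := hSf.mem_toFinset.1 hxS
    rw [← ncard_orbit hx him, ← Set.ncard_coe_finset]
    congr 1
    ext y
    simp only [Finset.coe_filter, Set.Finite.mem_toFinset, Set.mem_ofPred_eq,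
      Set.mem_insert_iff, Set.mem_singleton_iff]
    obtain ⟨F, hF, hFc⟩ := hΦ x hx him
    constructor
    · rintro ⟨⟨⟨hy, -⟩, hyim⟩, hyx⟩
      obtain ⟨G, hG, hGc⟩ := hΦ y hy hyim
      have hGF : G ≈ F := Quotient.exact (hGc.symm.trans (hyx.trans hFc))
      exact hF.eq hx hy (hG.of_equiv hGF)
    · intro h
      obtain ⟨h1, h2, h3, h4⟩ := isReduced_orbit hx h
      have hyim : y.im ≠ 0 := fun h => him (h4.1 h)
      have hcond : EisensteinInt.conductor y = EisensteinInt.conductor x := by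
        unfold EisensteinInt.conductor
        rw [h1]
        simp only [h3]
      refine ⟨⟨⟨h2, by rw [hcond]; exact hxX⟩, hyim⟩, ?_⟩
      have hFy : F.Attached y := by
        rcases h with rfl | rfl | rfl | rfl
        exacts [hF, hF.neg, hF.star, hF.star.neg]
      obtain ⟨G, hG, hGc⟩ := hΦ y h2 hyim
      rw [hGc, hFc]
      exact Quotient.sound (hG.equiv h2 hFy)
  have hcard : hSf.toFinset.card = (hSf.toFinset.image Φ).card * 4 :=
    (Finset.card_eq_sum_card_image Φ _).trans (Finset.sum_const_nat hfib)
  rw [himg, Set.ncard_eq_toFinset_card _ hSf, hcard, mul_comm,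
    Set.ncard_eq_toFinset_card _ (hSf.image Φ), Set.Finite.toFinset_image]

/-- The summand 2 accounts for ±1, the reduced elements with h = 0; their conductor is 1, whence X >
1. -/
theorem card_discrLT {X : ℝ} (hX : 1 < X) :
    4 * (discrLT X).ncard + 2 = 2 * ∑ n ∈ Finset.range ⌈√X⌉₊, reducedCount n +
      4 * ∑ n ∈ Finset.range ⌈√X / 9⌉₊, reducedCount n := by
  have h1 : {x | x ∈ reducedLT X ∧ x.im ≠ 0} ∪ {x | x ∈ reducedLT X ∧ x.im = 0} =
      reducedLT X := by
    ext x
    simp only [Set.mem_union, Set.mem_ofPred_eq, ← and_or_left]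
    tauto
  have h2 : Disjoint {x | x ∈ reducedLT X ∧ x.im ≠ 0} {x | x ∈ reducedLT X ∧ x.im = 0} := by
    rw [Set.disjoint_left]
    rintro x ⟨-, h⟩ ⟨-, h'⟩
    exact h h'
  have h3 := Set.ncard_union_eq h2 ((finite_reducedLT X).subset fun x hx => hx.1)
    ((finite_reducedLT X).subset fun x hx => hx.1)
  rw [h1, ncard_reducedLT, ncard_reducedLT_im_eq_zero hX,
    ← (finite_and_card_discrLT X).2] at h3
  exact h3.symm

end AbelianCubicField

end

/-! ### The counting function as a multiplicative function and its local factors -/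

section

open EisensteinInt ArithmeticFunction
open scoped ArithmeticFunction.zeta ArithmeticFunction.Moebius

/-- The nontrivial Dirichlet character modulo `3`. -/
noncomputable def chiThree : ArithmeticFunction ℝ :=
  ⟨fun n => if n % 3 = 1 then 1 else if n % 3 = 2 then -1 else 0, by simp⟩

theorem chiThree_apply (n : ℕ) :
    chiThree n = if n % 3 = 1 then 1 else if n % 3 = 2 then -1 else 0 := rfl

theorem chiThree_one : chiThree 1 = 1 := by simp [chiThree_apply]

theorem chiThree_mul (m n : ℕ) : chiThree (m * n) = chiThree m * chiThree n := by
  rw [chiThree_apply, chiThree_apply, chiThree_apply, Nat.mul_mod]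
  rcases (by omega : m % 3 = 0 ∨ m % 3 = 1 ∨ m % 3 = 2) with h | h | h <;>
    rcases (by omega : n % 3 = 0 ∨ n % 3 = 1 ∨ n % 3 = 2) with h' | h' | h' <;> simp [h, h']

theorem isMultiplicative_chiThree : chiThree.IsMultiplicative :=
  ⟨chiThree_one, fun {m n} _ => chiThree_mul m n⟩

/-- The number of Eisenstein primes above `p`, counted if they have degree one and are
unramified. -/
noncomputable def splitCount (p : ℕ) : ℝ := if p = 3 then 0 else 1 + chiThree p

/-- The multiplicative function counting primary reduced Eisenstein integers. -/
noncomputable def reducedCountFn : ArithmeticFunction ℝ :=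
  pmul (pmul (μ : ArithmeticFunction ℝ) (μ : ArithmeticFunction ℝ)) (prodPrimeFactors splitCount)

theorem isMultiplicative_moebius_real : (μ : ArithmeticFunction ℝ).IsMultiplicative :=
  isMultiplicative_moebius.intCast

theorem isMultiplicative_reducedCountFn : reducedCountFn.IsMultiplicative :=
  (isMultiplicative_moebius_real.pmul isMultiplicative_moebius_real).pmul
    (IsMultiplicative.prodPrimeFactors _)

theorem primaryCount_eq_prod (n : ℕ) : Squarefree n → ¬ 3 ∣ n →
    (primaryCount n : ℝ) = ∏ p ∈ n.primeFactors, splitCount p := by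
  induction n using induction_on_primes with
  | zero => intro h; simp at h
  | one => intro _ _; simp [primaryCount_one]
  | prime_mul p a hp ih =>
    intro hsf h3
    have hcop := Nat.coprime_of_squarefree_mul hsf
    have hpa : ¬ p ∣ a := (Nat.Prime.coprime_iff_not_dvd hp).1 hcop
    have ha : a ≠ 0 := by rintro rfl; simp at hpa
    have h3p : ¬ 3 ∣ p := fun h => h3 (h.mul_right a)
    have h3a : ¬ 3 ∣ a := fun h => h3 (h.mul_left p)
    rw [Nat.primeFactors_mul hp.ne_zero ha, hp.primeFactors,
      Finset.prod_union (by simpa [hp, ha] using hpa), Finset.prod_singleton,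
      ← ih hsf.of_mul_right h3a]
    have hp3 : p ≠ 3 := by rintro rfl; exact h3p dvd_rfl
    rcases (by omega : p % 3 = 1 ∨ p % 3 = 2) with h | h
    · rw [primaryCount_prime_mul hp h hpa, splitCount, if_neg hp3, chiThree_apply, if_pos h]
      push_cast; ring
    · rw [primaryCount_eq_zero hp h (dvd_mul_right _ _) hsf, splitCount, if_neg hp3,
        chiThree_apply, h]
      norm_num

theorem reducedCount_eq (n : ℕ) : (reducedCount n : ℝ) = reducedCountFn n := by
  rcases eq_or_ne n 0 with rfl | hn
  · simp [reducedCount]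
  rw [reducedCountFn, pmul_apply, pmul_apply, prodPrimeFactors_apply hn, reducedCount]
  split_ifs with h
  · rw [primaryCount_eq_prod n h.1 h.2]
    have := moebius_sq_eq_one_of_squarefree h.1
    have h2 : ((μ n : ℤ) : ℝ) * (μ n : ℤ) = 1 := by
      exact_mod_cast (by rw [← this]; ring : μ n * μ n = 1)
    simp [h2]
  · by_cases hs : Squarefree n
    · have h3 : 3 ∣ n := by tauto
      rw [Finset.prod_eq_zero (i := 3) (by simp [Nat.prime_three, h3, hn]) (by simp [splitCount])]
      simp
    · simp [moebius_eq_zero_of_not_squarefree hs]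

/-- The factor relating `reducedCountFn` to the Dedekind zeta function `ζ * chiThree`. -/
noncomputable def correction : ArithmeticFunction ℝ :=
  (μ : ArithmeticFunction ℝ) * pmul (μ : ArithmeticFunction ℝ) chiThree * reducedCountFn

theorem isMultiplicative_correction : correction.IsMultiplicative :=
  (isMultiplicative_moebius_real.mul
    (isMultiplicative_moebius_real.pmul isMultiplicative_chiThree)).mul
    isMultiplicative_reducedCountFn

/-- Complete multiplicativity pulls χ(n) out of the convolution and leaves μ * ζ. -/
theorem moebius_chiThree_mul : pmul (μ : ArithmeticFunction ℝ) chiThree * chiThree = 1 := by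
  ext n
  have h : (pmul (μ : ArithmeticFunction ℝ) chiThree * chiThree) n =
      chiThree n * ((μ : ArithmeticFunction ℝ) * (ζ : ArithmeticFunction ℝ)) n := by
    rw [mul_apply, mul_apply, Finset.mul_sum]
    refine Finset.sum_congr rfl fun d hd => ?_
    obtain ⟨h1, h2⟩ := Nat.mem_divisorsAntidiagonal.1 hd
    have hd2 : d.2 ≠ 0 := by rintro h0; rw [h0, mul_zero] at h1; exact h2 h1.symm
    rw [← h1, chiThree_mul, pmul_apply]
    simp [hd2]
    ring
  rw [h, coe_moebius_mul_coe_zeta]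
  rcases eq_or_ne n 1 with rfl | hn
  · simp [chiThree_one]
  · simp [one_apply_ne hn]

theorem zeta_mul_chiThree_mul_correction :
    ((ζ : ArithmeticFunction ℝ) * chiThree) * correction = reducedCountFn := by
  have h1 := moebius_chiThree_mul
  have h2 : (μ : ArithmeticFunction ℝ) * (ζ : ArithmeticFunction ℝ) = 1 :=
    coe_moebius_mul_coe_zeta
  calc _ = ((μ : ArithmeticFunction ℝ) * (ζ : ArithmeticFunction ℝ)) *
        (pmul (μ : ArithmeticFunction ℝ) chiThree * chiThree) * reducedCountFn := by
        rw [correction]; ring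
    _ = _ := by rw [h1, h2, one_mul, one_mul]

section Local

open PowerSeries

/-- The generating series of the values of an arithmetic function at the powers of `p`. -/
noncomputable def localSeries (p : ℕ) (f : ArithmeticFunction ℝ) : PowerSeries ℝ :=
  PowerSeries.mk fun k => f (p ^ k)

theorem localSeries_mul {p : ℕ} (hp : p.Prime) (f g : ArithmeticFunction ℝ) :
    localSeries p (f * g) = localSeries p f * localSeries p g := by
  ext k
  rw [localSeries, coeff_mk, coeff_mul, ArithmeticFunction.mul_apply,
    Nat.sum_divisorsAntidiagonal fun i j => f i * g j, Nat.sum_divisors_prime_pow hp,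
    Finset.Nat.sum_antidiagonal_eq_sum_range_succ_mk]
  refine Finset.sum_congr rfl fun i hi => ?_
  rw [Nat.pow_div (Nat.lt_succ_iff.1 (Finset.mem_range.1 hi)) hp.pos]
  simp [localSeries]

/-- Convolution becomes multiplication of local series. The result is a cubic polynomial; its linear
coefficient, `splitCount p` − 1 − χ(p), vanishes for p ≠ 3, which makes the series of `correction`
converge at 1. -/
theorem localSeries_correction {p : ℕ} (hp : p.Prime) :
    localSeries p correction =
      (1 - X) * (1 - C (chiThree p) * X) * (1 + C (splitCount p) * X) := by
  have h1 : localSeries p (μ : ArithmeticFunction ℝ) = 1 - X := by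
    ext k
    rw [localSeries, coeff_mk, map_sub, coeff_one, coeff_X]
    rcases k with _ | _ | k
    · simp
    · simp [moebius_apply_prime hp]
    · simp [moebius_apply_prime_pow hp]
  have h2 : localSeries p (pmul (μ : ArithmeticFunction ℝ) chiThree) =
      1 - C (chiThree p) * X := by
    ext k
    rw [localSeries, coeff_mk, map_sub, coeff_one, coeff_C_mul, coeff_X]
    rcases k with _ | _ | k
    · simp [chiThree_one]
    · simp [moebius_apply_prime hp]
    · simp [moebius_apply_prime_pow hp]
  have h3 : localSeries p reducedCountFn = 1 + C (splitCount p) * X := by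
    ext k
    rw [localSeries, coeff_mk, map_add, coeff_one, coeff_C_mul, coeff_X, reducedCountFn]
    rcases k with _ | _ | k
    · simp [prodPrimeFactors_apply]
    · simp [moebius_apply_prime hp, prodPrimeFactors_apply hp.ne_zero, hp.primeFactors]
    · simp [moebius_apply_prime_pow hp]
  rw [correction, localSeries_mul hp, localSeries_mul hp, h1, h2, h3]

theorem correction_prime_pow {p : ℕ} (hp : p.Prime) (k : ℕ) :
    correction (p ^ k) = if k = 0 then 1 else if k = 1 then splitCount p - 1 - chiThree p else
      if k = 2 then chiThree p - splitCount p * (1 + chiThree p) else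
      if k = 3 then splitCount p * chiThree p else 0 := by
  have h : correction (p ^ k) = coeff k (localSeries p correction) := by
    rw [localSeries, coeff_mk]
  have e : (1 - X) * (1 - C (chiThree p) * X) * (1 + C (splitCount p) * X) =
      (1 : PowerSeries ℝ) + C (splitCount p - 1 - chiThree p) * X ^ 1 +
      C (chiThree p - splitCount p * (1 + chiThree p)) * X ^ 2 +
      C (splitCount p * chiThree p) * X ^ 3 := by
    simp only [map_sub, map_add, map_mul, map_one]
    ring
  rw [h, localSeries_correction hp, e]
  simp only [map_add, coeff_C_mul, coeff_X_pow, coeff_one]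
  rcases k with _ | _ | _ | _ | k <;> simp

end Local

end

/-! ### The Euler product of the correction factor -/

section

open EisensteinInt ArithmeticFunction
open scoped ArithmeticFunction.zeta ArithmeticFunction.Moebius Topology

theorem chiThree_eq (n : ℕ) : n % 3 = 0 ∧ chiThree n = 0 ∨ n % 3 = 1 ∧ chiThree n = 1 ∨
    n % 3 = 2 ∧ chiThree n = -1 := by
  rw [chiThree_apply]
  rcases (by omega : n % 3 = 0 ∨ n % 3 = 1 ∨ n % 3 = 2) with h | h | h <;> simp [h]

/-- `correction n / n`. -/
noncomputable def correctionDiv : ArithmeticFunction ℝ := ⟨fun n => correction n / n, by simp⟩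

theorem correctionDiv_apply (n : ℕ) : correctionDiv n = correction n / n := rfl

theorem isMultiplicative_correctionDiv : correctionDiv.IsMultiplicative := by
  refine ⟨by simp [correctionDiv_apply, isMultiplicative_correction.1], fun {m n} h => ?_⟩
  rw [correctionDiv_apply, correctionDiv_apply, correctionDiv_apply,
    isMultiplicative_correction.2 h]
  push_cast
  rw [mul_div_mul_comm]

theorem correctionDiv_prime_pow_eq_zero {p : ℕ} (hp : p.Prime) {k : ℕ} (hk : k ∉ Finset.range 4) :
    correctionDiv (p ^ k) = 0 := by
  have : 4 ≤ k := by simpa using hk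
  rw [correctionDiv_apply, correction_prime_pow hp, if_neg (by omega), if_neg (by omega),
    if_neg (by omega), if_neg (by omega), zero_div]

theorem tsum_correctionDiv_prime_pow {p : ℕ} (hp : p.Prime) :
    ∑' k, correctionDiv (p ^ k) =
      (1 - 1 / (p : ℝ)) * (1 - chiThree p / p) * (1 + splitCount p / p) := by
  rw [tsum_eq_sum fun k hk => correctionDiv_prime_pow_eq_zero hp hk]
  simp only [Finset.sum_range_succ, Finset.sum_range_zero, correctionDiv_apply,
    correction_prime_pow hp]
  have : (p : ℝ) ≠ 0 := by exact_mod_cast hp.ne_zero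
  norm_num
  field_simp
  ring

/-- The sum is 1 + 3/p² + 2/p³ for p ≡ 1, 1 + 1/p² for p ≡ 2, and 1 + 1/3 for p = 3; the constant 5
covers all three. -/
theorem sum_abs_correctionDiv_prime_pow_le {p : ℕ} (hp : p.Prime) :
    ∑' k, |correctionDiv (p ^ k)| ≤ 1 + 5 / (p : ℝ) ^ 2 := by
  rw [tsum_eq_sum fun k hk => by rw [correctionDiv_prime_pow_eq_zero hp hk, abs_zero]]
  simp only [Finset.sum_range_succ, Finset.sum_range_zero, correctionDiv_apply,
    correction_prime_pow hp]
  have hp2 : (2 : ℝ) ≤ p := by exact_mod_cast hp.two_le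
  by_cases h3 : p = 3
  · subst h3
    simp [splitCount, chiThree_apply]
    norm_num
  · have hm : p % 3 ≠ 0 := fun h => h3 ((Nat.prime_dvd_prime_iff_eq Nat.prime_three hp).1
      (Nat.dvd_of_mod_eq_zero h)).symm
    rw [splitCount, if_neg h3]
    rcases chiThree_eq p with h | ⟨-, h⟩ | ⟨-, h⟩
    · exact absurd h.1 hm
    · have h1 : 2 / (p : ℝ) ^ 3 ≤ 2 / (p : ℝ) ^ 2 := by
        apply div_le_div_of_nonneg_left (by norm_num) (by positivity)
        exact pow_le_pow_right₀ (by linarith) (by norm_num)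
      rw [h]
      norm_num [abs_div]
      have e : (5 : ℝ) / p ^ 2 = 3 / p ^ 2 + 2 / p ^ 2 := by ring
      rw [e]
      linarith
    · rw [h]
      norm_num [abs_div]
      have e : (5 : ℝ) / p ^ 2 = ((p : ℝ) ^ 2)⁻¹ + 4 / p ^ 2 := by ring
      have : 0 ≤ 4 / (p : ℝ) ^ 2 := by positivity
      rw [e]
      linarith

theorem summable_five_div_sq : Summable fun n : ℕ => (5 : ℝ) / (n : ℝ) ^ 2 := by
  have := (Real.summable_one_div_nat_pow (p := 2)).2 (by norm_num)
  exact (this.mul_left 5).congr fun n => by ring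

/-- The Dirichlet series of `correction` converges absolutely at `1`. -/
theorem summable_abs_correctionDiv : Summable fun n => |correctionDiv n| := by
  have hm := isMultiplicative_correctionDiv
  set c : ℝ := Real.exp (∑' n : ℕ, (5 : ℝ) / (n : ℝ) ^ 2)
  refine summable_of_sum_range_le (c := c) (fun _ => abs_nonneg _) fun N => ?_
  obtain ⟨h1, h2⟩ := EulerProduct.summable_and_hasSum_smoothNumbers_prod_primesBelow_tsum
    (f := fun n => |correctionDiv n|) (by simp [hm.1])
    (fun {m n} h => by rw [hm.2 h, abs_mul])
    (fun {p} hp => summable_of_ne_finset_zero (s := Finset.range 4) fun k hk => by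
      rw [correctionDiv_prime_pow_eq_zero hp hk]; simp) N
  -- Every positive n < N is N-smooth, so the partial sum is bounded by the finite Euler product
  -- over primes below N.
  have h3 : ∑ n ∈ Finset.range N, |correctionDiv n| ≤
      ∑' m : N.smoothNumbers, |correctionDiv m| := by
    classical
    have hsub : ∀ n ∈ (Finset.range N).filter (· ≠ 0), n ∈ N.smoothNumbers := by
      intro n hn
      simp only [Finset.mem_filter, Finset.mem_range] at hn
      exact Nat.mem_smoothNumbers_of_lt (Nat.pos_of_ne_zero hn.2) hn.1
    have h4 : ∑ n ∈ Finset.range N, |correctionDiv n| =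
        ∑ m ∈ ((Finset.range N).filter (· ≠ 0)).subtype (· ∈ N.smoothNumbers),
          |correctionDiv m| := by
      rw [Finset.sum_subtype_of_mem (fun n => |correctionDiv n|) hsub]
      symm
      apply Finset.sum_filter_of_ne
      intro n _ hn h0
      simp [h0] at hn
    rw [h4]
    exact h2.summable.sum_le_tsum _ fun _ _ => abs_nonneg _
  refine h3.trans ?_
  rw [h2.tsum_eq]
  calc ∏ p ∈ N.primesBelow, ∑' k, |correctionDiv (p ^ k)|
      ≤ ∏ p ∈ N.primesBelow, Real.exp (5 / (p : ℝ) ^ 2) := by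
        refine Finset.prod_le_prod (fun p _ => tsum_nonneg fun _ => abs_nonneg _) fun p hp => ?_
        refine (sum_abs_correctionDiv_prime_pow_le (Nat.prime_of_mem_primesBelow hp)).trans ?_
        rw [add_comm]
        exact Real.add_one_le_exp _
    _ = Real.exp (∑ p ∈ N.primesBelow, 5 / (p : ℝ) ^ 2) := by rw [Real.exp_sum]
    _ ≤ c := by
        refine Real.exp_le_exp.2 ?_
        exact summable_five_div_sq.sum_le_tsum _ fun _ _ => by positivity

theorem hasProd_correctionDiv :
    HasProd (fun p : Nat.Primes => (1 - 1 / ((p : ℕ) : ℝ)) * (1 - chiThree p / ((p : ℕ) : ℝ)) *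
      (1 + splitCount p / ((p : ℕ) : ℝ))) (∑' n, correctionDiv n) := by
  have h := isMultiplicative_correctionDiv.eulerProduct_hasProd summable_abs_correctionDiv
  have e : (fun p : Nat.Primes => ∑' k, correctionDiv ((p : ℕ) ^ k)) = _ :=
    funext fun p => tsum_correctionDiv_prime_pow p.2
  rwa [e] at h

theorem hasProd_one_sub_sq :
    HasProd (fun p : Nat.Primes => (1 - 1 / ((p : ℕ) : ℝ) ^ 2)) (6 / Real.pi ^ 2) := by
  let f : ℕ →*₀ ℝ :=
    { toFun := fun n => 1 / (n : ℝ) ^ 2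
      map_zero' := by simp
      map_one' := by simp
      map_mul' := fun m n => by push_cast; ring }
  have hs : Summable fun n => ‖f n‖ := hasSum_zeta_two.summable.norm
  have h := EulerProduct.eulerProduct_completely_multiplicative_hasProd hs
  have h6 : ∑' n, f n = Real.pi ^ 2 / 6 := hasSum_zeta_two.tsum_eq
  rw [h6] at h
  have h' := h.inv₀ (by positivity)
  simpa [f] using h'

/-- The factor of the Euler product at `p`, normalized by that of `1 / ζ(2)`. -/
noncomputable def normalizedFactor (p : ℕ) : ℝ :=
  if p = 3 then 3 / 4 else if p % 3 = 1 then 1 - 2 / ((p : ℝ) * (p + 1)) else 1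

theorem normalizedFactor_mul {p : ℕ} (hp : p.Prime) :
    normalizedFactor p * (1 - 1 / (p : ℝ) ^ 2) =
      (1 - 1 / (p : ℝ)) * (1 - chiThree p / p) * (1 + splitCount p / p) := by
  have hp0 : (p : ℝ) ≠ 0 := by exact_mod_cast hp.ne_zero
  have hp1 : (p : ℝ) + 1 ≠ 0 := by positivity
  rw [normalizedFactor, splitCount]
  by_cases h3 : p = 3
  · subst h3
    simp [chiThree_apply]
    norm_num
  · have hm : p % 3 ≠ 0 := fun h => h3 ((Nat.prime_dvd_prime_iff_eq Nat.prime_three hp).1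
      (Nat.dvd_of_mod_eq_zero h)).symm
    rw [if_neg h3, if_neg h3]
    rcases chiThree_eq p with h | ⟨h', h⟩ | ⟨h', h⟩
    · exact absurd h.1 hm
    · rw [if_pos h', h]
      field_simp
      ring
    · rw [if_neg (by omega), h]
      field_simp
      ring

theorem multipliable_primeOneModThree :
    Multipliable fun p : PrimeOneModThree => 1 - 2 / ((p.1 : ℝ) * ((p.1 : ℝ) + 1)) := by
  have h : Summable fun p : PrimeOneModThree => -(2 / ((p.1 : ℝ) * ((p.1 : ℝ) + 1))) := by
    refine Summable.neg ?_
    have h5 := summable_five_div_sq.comp_injective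
      (i := fun p : PrimeOneModThree => p.1) Subtype.val_injective
    refine Summable.of_nonneg_of_le (fun _ => by positivity) (fun p => ?_) h5
    have hp : (0 : ℝ) < p.1 := by exact_mod_cast p.2.1.pos
    simp only [Function.comp]
    rw [div_le_div_iff₀ (by positivity) (by positivity)]
    nlinarith
  simpa [sub_eq_add_neg] using Real.multipliable_one_add_of_summable h

/-- Dividing the local factors by 1 − 1/p² leaves 1 − 2/(p(p+1)) at p ≡ 1, 1 at p ≡ 2 and 3/4 at p =
3; the constant is (3/4) · 6/π². -/
theorem tsum_correctionDiv : ∑' n, correctionDiv n = 9 / (2 * Real.pi ^ 2) *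
    ∏' p : PrimeOneModThree, (1 - 2 / ((p.1 : ℝ) * ((p.1 : ℝ) + 1))) := by
  classical
  set Q := ∏' p : PrimeOneModThree, (1 - 2 / ((p.1 : ℝ) * ((p.1 : ℝ) + 1))) with hQ
  let i : PrimeOneModThree → Nat.Primes := fun p => ⟨p.1, p.2.1⟩
  have hi : Function.Injective i := fun p q h => Subtype.ext (congrArg Subtype.val h :)
  let three : Nat.Primes := ⟨3, Nat.prime_three⟩
  have h1 : HasProd (fun p : Nat.Primes => if (p : ℕ) % 3 = 1 then
      1 - 2 / (((p : ℕ) : ℝ) * ((p : ℕ) + 1)) else 1) Q := by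
    rw [← hi.hasProd_iff]
    · have h := multipliable_primeOneModThree.hasProd
      convert h using 2 with p
      exact if_pos p.2.2
    · intro p hp
      rw [if_neg]
      intro h
      exact hp ⟨⟨p, p.2, h⟩, rfl⟩
  have h2 : HasProd (fun p : Nat.Primes => if p = three then (3 / 4 : ℝ) else 1) (3 / 4) :=
    hasProd_ite_eq _ _
  have h3 := (h1.mul h2).mul hasProd_one_sub_sq
  have h4 : ∑' n, correctionDiv n = Q * (3 / 4) * (6 / Real.pi ^ 2) := by
    refine hasProd_correctionDiv.unique ?_
    convert h3 using 2 with p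
    rw [← normalizedFactor_mul p.2, normalizedFactor]
    congr 1
    by_cases hp : p = three
    · subst hp
      rw [if_pos rfl, if_pos rfl, if_neg (by norm_num [three]), one_mul]
    · have hp3 : (p : ℕ) ≠ 3 := fun h => hp (Subtype.ext h)
      rw [if_neg hp, if_neg hp3, mul_one]
  rw [h4]
  ring

end

/-! ### The value L(1, χ) and the mean value of ζ * χ -/

section

open ArithmeticFunction
open scoped ArithmeticFunction.zeta Topology

/-- The partial sums of the series for `L(1, chiThree)`. -/
noncomputable def chiThreePartial (K : ℕ) : ℝ :=
  ∑ k ∈ Finset.range K, (1 / (3 * (k : ℝ) + 1) - 1 / (3 * (k : ℝ) + 2))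

theorem chiThreePartial_add_antitone :
    Antitone fun K => chiThreePartial K + 1 / (3 * (K : ℝ) + 1) := by
  refine antitone_nat_of_succ_le fun K => ?_
  rw [chiThreePartial, Finset.sum_range_succ, ← chiThreePartial]
  have : 1 / (3 * (K : ℝ) + 4) ≤ 1 / (3 * (K : ℝ) + 2) := by
    apply one_div_le_one_div_of_le (by positivity); linarith
  have e : 3 * ((K + 1 : ℕ) : ℝ) + 1 = 3 * (K : ℝ) + 4 := by push_cast; ring
  rw [e]
  linarith

theorem chiThreePartial_mono : Monotone chiThreePartial := by
  refine monotone_nat_of_le_succ fun K => ?_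
  rw [chiThreePartial, chiThreePartial, Finset.sum_range_succ]
  have : 1 / (3 * (K : ℝ) + 2) ≤ 1 / (3 * (K : ℝ) + 1) := by
    apply one_div_le_one_div_of_le (by positivity); linarith
  linarith

theorem tendsto_one_div_three_mul_add_one :
    Tendsto (fun K : ℕ => 1 / (3 * (K : ℝ) + 1)) atTop (𝓝 0) := by
  simp_rw [one_div]
  refine tendsto_inv_atTop_zero.comp (tendsto_atTop_add_const_right _ _ ?_)
  exact tendsto_natCast_atTop_atTop.const_mul_atTop (by norm_num)

theorem mul_cot_pi_div_three :
    (Real.pi : ℂ) * Complex.cot (Real.pi * (1 / 3)) - 1 / (1 / 3) =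
      ((Real.pi / √3 - 3 : ℝ) : ℂ) := by
  have h : (Real.pi : ℂ) * (1 / 3) = ((Real.pi / 3 : ℝ) : ℂ) := by push_cast; ring
  rw [h, Complex.cot, ← Complex.ofReal_cos, ← Complex.ofReal_sin, Real.cos_pi_div_three,
    Real.sin_pi_div_three]
  have : (√3 : ℝ) ≠ 0 := by positivity
  rw [← Complex.ofReal_div, ← Complex.ofReal_mul]
  have e : Real.pi * (1 / 2 / (√3 / 2)) = Real.pi / √3 := by field_simp
  rw [e]
  push_cast
  norm_num

/-- The partial fraction expansion of π cot(πz) at z = 1/3 has, up to a boundary term and an affine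
change, the same partial sums; and π cot(π/3) = π/√3. -/
theorem tendsto_chiThreePartial :
    Tendsto chiThreePartial atTop (𝓝 (Real.pi / (3 * √3))) := by
  have hz : (1 / 3 : ℂ) ∈ Complex.integerComplement := by
    rintro ⟨n, hn⟩
    have h3 : (3 * n : ℤ) = 1 := by
      have : (3 * n : ℂ) = 1 := by rw [hn]; norm_num
      exact_mod_cast this
    omega
  have h := (summable_cotTerm hz).hasSum.tendsto_sum_nat
  rw [show ∑' n, cotTerm (1 / 3 : ℂ) n = _ from (cot_series_rep' hz).symm,
    mul_cot_pi_div_three] at h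
  have hk : ∀ K : ℕ, ∑ n ∈ Finset.range K, cotTerm (1 / 3 : ℂ) n =
      ((3 * (chiThreePartial K + 1 / (3 * (K : ℝ) + 1) - 1) : ℝ) : ℂ) := by
    intro K
    induction K with
    | zero => simp [chiThreePartial]
    | succ K ih =>
      rw [Finset.sum_range_succ, ih, chiThreePartial, chiThreePartial, Finset.sum_range_succ]
      have e : cotTerm (1 / 3 : ℂ) K =
          ((1 / (1 / 3 - ((K : ℝ) + 1)) + 1 / (1 / 3 + ((K : ℝ) + 1)) : ℝ) : ℂ) := by
        simp [cotTerm]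
      rw [e, ← Complex.ofReal_add]
      congr 1
      have h1 : 3 * (K : ℝ) + 1 ≠ 0 := by positivity
      have h2 : 3 * (K : ℝ) + 2 ≠ 0 := by positivity
      have h4 : 3 * (K : ℝ) + 4 ≠ 0 := by positivity
      have e1 : 1 / (1 / 3 - ((K : ℝ) + 1)) = - 3 * (1 / (3 * (K : ℝ) + 2)) := by
        have : 1 / 3 - ((K : ℝ) + 1) = - (3 * (K : ℝ) + 2) / 3 := by ring
        rw [this]; field_simp
      have e2 : 1 / (1 / 3 + ((K : ℝ) + 1)) = 3 * (1 / (3 * (K : ℝ) + 4)) := by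
        have : 1 / 3 + ((K : ℝ) + 1) = (3 * (K : ℝ) + 4) / 3 := by ring
        rw [this]; field_simp
      have e3 : 3 * ((K + 1 : ℕ) : ℝ) + 1 = 3 * (K : ℝ) + 4 := by push_cast; ring
      rw [e1, e2, e3]
      ring
  simp_rw [hk] at h
  have h' := (Complex.continuous_re.tendsto _).comp h
  simp only [Function.comp_def, Complex.ofReal_re] at h'
  have h2 := ((h'.div_const 3).add_const 1).sub tendsto_one_div_three_mul_add_one
  convert h2 using 2
  · ring
  · have : (√3 : ℝ) ≠ 0 := by positivity
    field_simp
    ring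

/-- The summatory function of `ζ * chiThree`. -/
noncomputable def zetaChiSum (m : ℕ) : ℝ :=
  ∑ n ∈ Finset.Ioc 0 m, ((ζ : ArithmeticFunction ℝ) * chiThree) n

/-- The partial sums of `∑ k, (⌊m / (3 k + 1)⌋ - ⌊m / (3 k + 2)⌋)`. -/
noncomputable def floorPartial (m K : ℕ) : ℝ :=
  ∑ k ∈ Finset.range K, (((m / (3 * k + 1) : ℕ) : ℝ) - ((m / (3 * k + 2) : ℕ) : ℝ))

theorem floorPartial_mono (m : ℕ) : Monotone (floorPartial m) := by
  refine monotone_nat_of_le_succ fun K => ?_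
  rw [floorPartial, floorPartial, Finset.sum_range_succ]
  have : ((m / (3 * K + 2) : ℕ) : ℝ) ≤ ((m / (3 * K + 1) : ℕ) : ℝ) := by
    exact_mod_cast Nat.div_le_div_left (by omega) (by omega)
  linarith

theorem floorPartial_add_antitone (m : ℕ) :
    Antitone fun K => floorPartial m K + ((m / (3 * K + 1) : ℕ) : ℝ) := by
  refine antitone_nat_of_succ_le fun K => ?_
  rw [floorPartial, Finset.sum_range_succ, ← floorPartial]
  have : ((m / (3 * (K + 1) + 1) : ℕ) : ℝ) ≤ ((m / (3 * K + 2) : ℕ) : ℝ) := by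
    exact_mod_cast Nat.div_le_div_left (by omega) (by omega)
  linarith

/-- Summing over divisors gives ∑ χ(n) ⌊m/n⌋, grouped here in blocks of three. Cutting at K = m
loses nothing, since ⌊m/n⌋ = 0 for n > m. -/
theorem zetaChiSum_eq (m : ℕ) : zetaChiSum m = floorPartial m m := by
  have h1 : ∀ K, ∑ n ∈ Finset.range (3 * K), chiThree (n + 1) * ((m / (n + 1) : ℕ) : ℝ) =
      floorPartial m K := by
    intro K
    induction K with
    | zero => simp [floorPartial]
    | succ K ih =>
      rw [show 3 * (K + 1) = 3 * K + 1 + 1 + 1 by ring, Finset.sum_range_succ,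
        Finset.sum_range_succ, Finset.sum_range_succ, ih, floorPartial, floorPartial,
        Finset.sum_range_succ, chiThree_apply, chiThree_apply, chiThree_apply,
        if_pos (by omega), if_neg (by omega), if_pos (by omega), if_neg (by omega),
        if_neg (by omega)]
      ring
  rw [zetaChiSum, mul_comm, sum_Ioc_mul_zeta_eq_sum, ← h1, Finset.range_eq_Ico,
    Finset.sum_Ico_add' (fun n => chiThree n * ((m / n : ℕ) : ℝ)) 0 (3 * m) 1]
  refine Finset.sum_subset (fun n hn => ?_) fun n hn hn' => ?_
  · simp only [Finset.mem_Ioc, Finset.mem_Ico] at hn ⊢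
    omega
  · simp only [Finset.mem_Ioc, Finset.mem_Ico, not_and, not_le] at hn hn'
    rw [Nat.div_eq_of_lt (hn' (by omega))]
    simp

theorem zetaChiSum_nonneg (m : ℕ) : 0 ≤ zetaChiSum m := by
  rw [zetaChiSum_eq]
  simpa [floorPartial] using floorPartial_mono m (Nat.zero_le m)

theorem zetaChiSum_le (m : ℕ) : zetaChiSum m ≤ m := by
  rw [zetaChiSum_eq]
  have h := floorPartial_add_antitone m (Nat.zero_le m)
  simp only [floorPartial, Finset.range_zero, Finset.sum_empty, mul_zero, zero_add,
    Nat.div_one] at h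
  rw [floorPartial]
  have : (0 : ℝ) ≤ ((m / (3 * m + 1) : ℕ) : ℝ) := by positivity
  linarith

theorem tendsto_div_div (d : ℕ) :
    Tendsto (fun m : ℕ => ((m / d : ℕ) : ℝ) / m) atTop (𝓝 (1 / d)) := by
  have h := (tendsto_nat_floor_mul_div_atTop (R := ℝ) (a := 1 / d) (by positivity)).comp
    tendsto_natCast_atTop_atTop
  refine h.congr fun m => ?_
  simp only [Function.comp]
  rw [one_div_mul_eq_div, Nat.floor_div_eq_div]

theorem tendsto_floorPartial (K : ℕ) :
    Tendsto (fun m : ℕ => floorPartial m K / m) atTop (𝓝 (chiThreePartial K)) := by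
  simp only [floorPartial, chiThreePartial, Finset.sum_div, sub_div]
  refine tendsto_finsetSum _ fun k _ => ?_
  have h1 := tendsto_div_div (3 * k + 1)
  have h2 := tendsto_div_div (3 * k + 2)
  push_cast at h1 h2
  exact h1.sub h2

/-- `∑ n ≤ m, (ζ * chiThree) n ~ L(1, chiThree) * m`. -/
theorem tendsto_zetaChiSum :
    Tendsto (fun m : ℕ => zetaChiSum m / m) atTop (𝓝 (Real.pi / (3 * √3))) := by
  set L := Real.pi / (3 * √3)
  rw [Metric.tendsto_atTop]
  intro ε hε
  -- Monotonicity places both L and `zetaChiSum m / m` within 1/(3K + 1) above the K-th partial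
  -- sums, so K can be fixed before m tends to infinity.
  obtain ⟨K, hK⟩ := ((tendsto_order.1 tendsto_one_div_three_mul_add_one).2 (ε / 2)
    (by positivity)).exists
  have h1 : chiThreePartial K ≤ L := chiThreePartial_mono.ge_of_tendsto tendsto_chiThreePartial K
  have h2 : L ≤ chiThreePartial K + 1 / (3 * (K : ℝ) + 1) := by
    have := tendsto_chiThreePartial.add tendsto_one_div_three_mul_add_one
    rw [add_zero] at this
    exact chiThreePartial_add_antitone.le_of_tendsto this K
  obtain ⟨N, hN⟩ := (Metric.tendsto_atTop.1 (tendsto_floorPartial K)) (ε / 2) (by positivity)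
  refine ⟨max N (max K 1), fun m hm => ?_⟩
  have hmK : K ≤ m := by omega
  have hm0 : (0 : ℝ) < m := by exact_mod_cast (by omega : 0 < m)
  have h3 := hN m (by omega)
  have h4 : floorPartial m K / m ≤ zetaChiSum m / m := by
    rw [zetaChiSum_eq]
    exact div_le_div_of_nonneg_right (floorPartial_mono m hmK) hm0.le
  have h5 : zetaChiSum m / m ≤ floorPartial m K / m + 1 / (3 * (K : ℝ) + 1) := by
    rw [zetaChiSum_eq]
    have h6 := floorPartial_add_antitone m hmK
    have h7 : (0 : ℝ) ≤ ((m / (3 * m + 1) : ℕ) : ℝ) := by positivity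
    have h8 : ((m / (3 * K + 1) : ℕ) : ℝ) ≤ (m : ℝ) / ((3 * K + 1 : ℕ) : ℝ) := Nat.cast_div_le
    have h9 : floorPartial m m ≤ floorPartial m K + m / ((3 * K + 1 : ℕ) : ℝ) := by
      simp only at h6
      linarith
    have h10 := div_le_div_of_nonneg_right h9 hm0.le
    refine h10.trans (le_of_eq ?_)
    push_cast
    field_simp
  rw [Real.dist_eq, abs_lt] at h3 ⊢
  constructor <;> linarith [h3.1, h3.2]

end

/-! ### Asymptotics -/

section

open EisensteinInt ArithmeticFunction
open scoped ArithmeticFunction.zeta Topology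

theorem sum_reducedCountFn_div (N : ℕ) :
    (∑ n ∈ Finset.Ioc 0 N, reducedCountFn n) / N =
      ∑' d, correction d * zetaChiSum (N / d) / N := by
  rw [← zeta_mul_chiThree_mul_correction, mul_comm, sum_Ioc_mul_eq_sum_sum, Finset.sum_div,
    tsum_eq_sum (s := Finset.Ioc 0 N)]
  · rfl
  · intro d hd
    simp only [Finset.mem_Ioc, not_and, not_le] at hd
    rcases Nat.eq_zero_or_pos d with rfl | h
    · simp
    · rw [Nat.div_eq_of_lt (hd h), zetaChiSum]
      simp

/-- Each term c(d) S(⌊N/d⌋)/N, with S = `zetaChiSum`, tends to L(1, χ) c(d)/d. Since 0 ≤ S(m) ≤ m,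
it is dominated by |c(d)|/d. -/
theorem tendsto_sum_reducedCountFn :
    Tendsto (fun N : ℕ => (∑ n ∈ Finset.Ioc 0 N, reducedCountFn n) / (N : ℝ)) atTop
      (𝓝 (Real.pi / (3 * √3) * ∑' n, correctionDiv n)) := by
  simp_rw [sum_reducedCountFn_div]
  rw [← tsum_mul_left]
  refine tendsto_tsum_of_dominated_convergence summable_abs_correctionDiv (fun d => ?_)
    (Eventually.of_forall fun N d => ?_)
  · rcases Nat.eq_zero_or_pos d with rfl | hd
    · simp
    have h1 := tendsto_zetaChiSum.comp (Nat.tendsto_div_const_atTop hd.ne')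
    have h2 := (h1.mul (tendsto_div_div d)).const_mul (correction d)
    rw [correctionDiv_apply]
    have e : Real.pi / (3 * √3) * (correction d / d) =
      correction d * (Real.pi / (3 * √3) * (1 / d)) := by ring
    rw [e]
    refine h2.congr fun N => ?_
    simp only [Function.comp]
    rcases Nat.eq_zero_or_pos (N / d) with h | h
    · simp [h, zetaChiSum]
    · have : ((N / d : ℕ) : ℝ) ≠ 0 := by exact_mod_cast h.ne'
      field_simp
  · rw [correctionDiv_apply, Real.norm_eq_abs, mul_div_assoc, abs_mul, div_eq_mul_one_div _ (d : ℝ),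
      abs_mul]
    refine mul_le_mul_of_nonneg_left ?_ (abs_nonneg _)
    rw [abs_of_nonneg (by have := zetaChiSum_nonneg (N / d); positivity),
      abs_of_nonneg (by positivity)]
    rcases Nat.eq_zero_or_pos N with rfl | hN
    · simp
    have hN' : (0 : ℝ) < N := by exact_mod_cast hN
    rw [div_le_iff₀ hN']
    refine (zetaChiSum_le _).trans (Nat.cast_div_le.trans (le_of_eq ?_))
    ring

theorem tendsto_sum_reducedCount :
    Tendsto (fun N : ℕ => ((∑ n ∈ Finset.range N, reducedCount n : ℕ) : ℝ) / (N : ℝ)) atTop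
      (𝓝 (√3 / (2 * Real.pi) *
        ∏' p : PrimeOneModThree, (1 - 2 / ((p.1 : ℝ) * ((p.1 : ℝ) + 1))))) := by
  have h := tendsto_sum_reducedCountFn
  rw [tsum_correctionDiv] at h
  have e : ∀ N : ℕ, ((∑ n ∈ Finset.range (N + 1), reducedCount n : ℕ) : ℝ) =
      ∑ n ∈ Finset.Ioc 0 N, reducedCountFn n := by
    intro N
    push_cast
    rw [Finset.range_eq_Ico, Finset.sum_eq_sum_Ico_succ_bot (by omega)]
    simp only [reducedCount_eq, ArithmeticFunction.map_zero, zero_add]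
    rfl
  -- `Finset.range (N + 1)` differs from `Ioc 0 N` only by n = 0, which contributes nothing; the
  -- factor N/(N + 1) corrects the denominator.
  refine (tendsto_add_atTop_iff_nat 1).1 ?_
  have h1 : Tendsto (fun N : ℕ => (N : ℝ) / ((N : ℝ) + 1)) atTop (𝓝 1) :=
    tendsto_natCast_div_add_atTop 1
  have h2 := h.mul h1
  have hc : √3 / (2 * Real.pi) *
        ∏' p : PrimeOneModThree, (1 - 2 / ((p.1 : ℝ) * ((p.1 : ℝ) + 1))) =
      Real.pi / (3 * √3) * (9 / (2 * Real.pi ^ 2) *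
        ∏' p : PrimeOneModThree, (1 - 2 / ((p.1 : ℝ) * ((p.1 : ℝ) + 1)))) * 1 := by
    have h3 : √3 ≠ 0 := by positivity
    have hpi := Real.pi_ne_zero
    field_simp
    rw [Real.sq_sqrt (by norm_num)]
    ring
  rw [hc]
  refine h2.congr fun N => ?_
  rw [e]
  rcases Nat.eq_zero_or_pos N with rfl | hN
  · simp
  have hN' : (N : ℝ) ≠ 0 := by exact_mod_cast hN.ne'
  push_cast
  field_simp

namespace AbelianCubicField

theorem tendsto_card_discrLT_div_sqrt :
    Tendsto (fun X : ℝ => ((discrLT X).ncard : ℝ) / √X) atTop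
      (𝓝 (11 * √3 / (36 * Real.pi) *
        ∏' p : PrimeOneModThree, (1 - 2 / ((p.1 : ℝ) * ((p.1 : ℝ) + 1))))) := by
  set c := ∏' p : PrimeOneModThree, (1 - 2 / ((p.1 : ℝ) * ((p.1 : ℝ) + 1)))
  have key : ∀ a : ℝ, 0 < a → Tendsto (fun X : ℝ =>
      ((∑ n ∈ Finset.range ⌈a * √X⌉₊, reducedCount n : ℕ) : ℝ) / √X) atTop
        (𝓝 (√3 / (2 * Real.pi) * c * a)) := by
    intro a ha
    have hX := Real.tendsto_sqrt_atTop.const_mul_atTop ha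
    have h1 := tendsto_sum_reducedCount.comp (tendsto_nat_ceil_atTop.comp hX)
    have h2 := (tendsto_nat_ceil_mul_div_atTop ha.le).comp Real.tendsto_sqrt_atTop
    refine (h1.mul h2).congr' ?_
    filter_upwards [eventually_gt_atTop 0] with X hX0
    have : 0 < a * √X := by positivity
    have h3 : ((⌈a * √X⌉₊ : ℕ) : ℝ) ≠ 0 := by
      exact_mod_cast (Nat.ceil_pos.2 this).ne'
    simp only [Function.comp]
    field_simp
  have h0 : Tendsto (fun X : ℝ => 1 / (2 * √X)) atTop (𝓝 0) := by
    simp_rw [one_div]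
    exact tendsto_inv_atTop_zero.comp (Real.tendsto_sqrt_atTop.const_mul_atTop two_pos)
  -- After division by 4, the weights are 1/2 at √X and 1 at √X/9, and the term 2 becomes 1/(2√X) →
  -- 0.
  have h := (((key 1 one_pos).div_const 2).add (key (1 / 9) (by norm_num))).sub h0
  have hc : 11 * √3 / (36 * Real.pi) * c =
      √3 / (2 * Real.pi) * c * 1 / 2 + √3 / (2 * Real.pi) * c * (1 / 9) - 0 := by
    have hpi := Real.pi_ne_zero
    field_simp
    ring
  rw [hc]
  refine h.congr' ?_
  filter_upwards [eventually_gt_atTop 1] with X hX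
  have h1 := card_discrLT hX
  have h2 : 4 * ((discrLT X).ncard : ℝ) + 2 =
      2 * ((∑ n ∈ Finset.range ⌈√X⌉₊, reducedCount n : ℕ) : ℝ) +
        4 * ((∑ n ∈ Finset.range ⌈√X / 9⌉₊, reducedCount n : ℕ) : ℝ) := by
    exact_mod_cast h1
  have hs : √X ≠ 0 := (Real.sqrt_pos.2 (by linarith)).ne'
  rw [one_mul, one_div_mul_eq_div]
  field_simp
  linarith

end AbelianCubicField

end

theorem theorem5 :
    (∀ X : ℝ, (AbelianCubicField.discrLT X).Finite) ∧
    Multipliable (fun p : PrimeOneModThree => 1 - 2 / ((p.1 : ℝ) * ((p.1 : ℝ) + 1))) ∧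
    (fun X : ℝ => ((AbelianCubicField.discrLT X).ncard : ℝ) -
        11 * √3 / (36 * Real.pi) *
          (∏' p : PrimeOneModThree, (1 - 2 / ((p.1 : ℝ) * ((p.1 : ℝ) + 1)))) *
          X ^ (1 / 2 : ℝ))
      =o[atTop] (fun X : ℝ => X ^ (1 / 2 : ℝ)) := by
  refine ⟨fun X => (AbelianCubicField.finite_and_card_discrLT X).1,
    multipliable_primeOneModThree, ?_⟩
  simp_rw [← Real.sqrt_eq_rpow]
  rw [isLittleO_iff_tendsto' ?_]
  · have h := AbelianCubicField.tendsto_card_discrLT_div_sqrt.sub_const (11 * √3 / (36 * Real.pi) *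
      ∏' p : PrimeOneModThree, (1 - 2 / ((p.1 : ℝ) * ((p.1 : ℝ) + 1))))
    rw [sub_self] at h
    refine h.congr' ?_
    filter_upwards [eventually_gt_atTop 0] with X hX
    have hs : √X ≠ 0 := (Real.sqrt_pos.2 hX).ne'
    rw [sub_div, mul_div_cancel_right₀ _ hs]
  · filter_upwards [eventually_gt_atTop 0] with X hX h
    exact absurd h (Real.sqrt_pos.2 hX).ne'
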